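/- Consider a sealed-bid first-price auction of one item among $n$ buyers with independent private values. Buyer $i$ has finitely many possible values $0\le v_i^1<v_i^2<\dots<v_i^{d_i}$, and has value $v_i^j$ with probability $p_i^j>0$, where $\sum_j p_i^j=1$; these distributions are publicly known. Every buyer places a nonnegative bid that does not exceed his value; a (randomized) strategy of buyer $i$ assigns to each value $v_i^j$ a probability distribution of bids on $[0,v_i^j]$. Buyers have quasi-linear utilities. The highest bidder wins and pays his bid; if several bids are highest, the tie is broken by a Vickrey auction among the highest bidders, in which each bids his value: a tied bidder of highest value wins (equally likely among those of equal value) and pays the larger of the tied bid and the largest value of the other tied bidders. A strategy profile is a Bayesian Nash equilibrium if, for every buyer $i$ and every value $v_i^j$, no nonnegative bid gives buyer $i$ with value $v_i^j$ a larger expected utility against the strategies of the other buyers than his own strategy does. Then, for all such discrete value distributions, a Bayesian Nash equilibrium exists. -/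

import Mathlib

open MeasureTheory

noncomputable section

/-- The publicly known data of a sealed-bid auction with `n` buyers with independent private values:
buyer `i` has the `d i` possible values `v i 0 < v i 1 < ⋯`, all nonnegative, and value `v i j` has
probability `p i j > 0`. -/
structure DiscreteAuction (n : ℕ) where
  d : Fin n → ℕ
  v : ∀ i, Fin (d i) → ℝ
  p : ∀ i, Fin (d i) → ℝ
  v_strictMono : ∀ i, StrictMono (v i)
  v_nonneg : ∀ i j, 0 ≤ v i j
  p_pos : ∀ i j, 0 < p i j
  p_sum : ∀ i, ∑ j, p i j = 1

namespace DiscreteAuction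

variable {n : ℕ}

/-- The buyers whose bid is highest. -/
def highestBidders (b : Fin n → ℝ) : Finset (Fin n) :=
  Finset.univ.filter fun i => ∀ k, b k ≤ b i

/-- The possible winners: the buyers of highest value among the highest bidders. -/
def winners (v b : Fin n → ℝ) : Finset (Fin n) :=
  (highestBidders b).filter fun i => ∀ k ∈ highestBidders b, v k ≤ v i

/-- What buyer `i` pays if he wins. A sole highest bidder pays his bid. In a tie a Vickrey auction
is run among the highest bidders, with the tied bid as reserve price, in which everyone bids his
value: the winner pays the largest value of the other highest bidders (which is at least the tied bid
when these do not overbid). -/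
def price (v b : Fin n → ℝ) (i : Fin n) : ℝ :=
  ((highestBidders b).erase i).fold max (b i) v

/-- The quasi-linear utility of buyer `i` when the values are `v` and the bids are `b`; several
possible winners (equal bids and equal values) are equally likely to receive the item. -/
def utility (v b : Fin n → ℝ) (i : Fin n) : ℝ :=
  if i ∈ winners v b then (v i - price v b i) / (winners v b).card else 0

/-- A profile of (randomized) bidding strategies: `bid i j` is the law of the bid of buyer `i` when
his value is `v i j`. Bids are nonnegative and nobody overbids. -/
structure Strategy (A : DiscreteAuction n) where
  bid : ∀ i, Fin (A.d i) → ProbabilityMeasure ℝ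
  bid_mem : ∀ i j, ∀ᵐ x ∂(bid i j : Measure ℝ), x ∈ Set.Icc 0 (A.v i j)

variable (A : DiscreteAuction n)

/-- The joint law of the value and the bid of buyer `k`. -/
def valueBidLaw (σ : A.Strategy) (k : Fin n) : Measure (ℝ × ℝ) :=
  ∑ j, ENNReal.ofReal (A.p k j) • (σ.bid k j : Measure ℝ).map fun x => (A.v k j, x)

instance (σ : A.Strategy) (k : Fin n) : IsProbabilityMeasure (A.valueBidLaw σ k) := by
  refine ⟨?_⟩
  have h : ∀ j, ((σ.bid k j : Measure ℝ).map fun x => (A.v k j, x)) Set.univ = 1 := fun j => by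
    rw [Measure.map_apply (by fun_prop) MeasurableSet.univ]
    simp
  simp only [valueBidLaw, Measure.coe_finsetSum, Finset.sum_apply, Measure.smul_apply, h,
    smul_eq_mul, mul_one]
  rw [← ENNReal.ofReal_sum_of_nonneg fun j _ => (A.p_pos k j).le, A.p_sum, ENNReal.ofReal_one]

/-- The expected utility of buyer `i` with value `v i j` who bids `x` while the other buyers, whose
values and bids are independent, follow `σ`: coordinate `i` of the random profile `ω` of values and
bids is overwritten by `(v i j, x)`. -/
def interimUtility (σ : A.Strategy) (i : Fin n) (j : Fin (A.d i)) (x : ℝ) : ℝ :=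
  ∫ ω : Fin n → ℝ × ℝ,
    utility (Function.update (fun k => (ω k).1) i (A.v i j))
      (Function.update (fun k => (ω k).2) i x) i
    ∂Measure.pi (A.valueBidLaw σ)

/-- `σ` is a Bayesian Nash equilibrium: no buyer, whatever his value, gains by replacing the bid
prescribed by his strategy by another nonnegative bid. -/
def IsBayesNash (σ : A.Strategy) : Prop :=
  ∀ (i : Fin n) (j : Fin (A.d i)) (x : ℝ), 0 ≤ x →
    A.interimUtility σ i j x ≤ ∫ y, A.interimUtility σ i j y ∂(σ.bid i j : Measure ℝ)

end DiscreteAuction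

end

/-!
The equilibrium is obtained from a minimax inequality of Ky Fan type for a single real function
of a strategy profile and a deviation, and not from equilibria of discretized auctions.

Call `v i - b i` the surplus of buyer `i`. Let every buyer and value choose an alternative bid that
wins all ties, with expected gains `interimGain (· ≤ ·)`, and compare the total of these gains with
the expectation of the largest surplus among the highest bidders (`surplus`). There is a profile `σ`
against which no choice of alternative bids gains more in total than the expected surplus
(`exists_interimGain_le`). Indeed a profile never gains against itself if its buyers lose all ties,
since at most one buyer outbids all others, and the gain with lost ties is linear in the deviation.
Replacing the gain and the surplus by continuous functions (`rampGain` from below,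
`relaxedSurplus` from above) makes the comparison continuous for the weak topology, in which the
strategy profiles form a compact space, and `exists_forall_nonpos` applies. Since a bid slightly
above `x` wins all ties at `x`, the limit yields gains with ties won.

Such a profile `σ` is an equilibrium (`isBayesNash_of_interimGain_le`). If all buyers win all ties
at their own bids, the gains of the tied buyers add up to at least the largest surplus, and by the
choice of `σ` their expected sum is at most its expectation. So the two agree almost surely, which
means that two tied buyers never both have a positive surplus. Then the Vickrey tie-break gives
each buyer exactly what he would get by winning all ties (`Sound.utility_eq`), the utilities add up
to the expected surplus, and a gainful deviation of one buyer would exceed it, because a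
deviation is never better than winning all ties.

The minimax inequality rests on Brouwer's fixed point theorem for the simplex
(`exists_fixedPoint_stdSimplex`), which is proved by a parity argument for dominating sets of
grid points, in the manner of Scarf (`exists_colorful_dominant`).
-/

/-! ### A parity argument for dominating sets -/

namespace FirstPrice

/-- A surjection from a finite set onto a set with one element fewer identifies exactly one pair. -/
theorem exists_unique_collision {A B : Type*} [DecidableEq A] [DecidableEq B]
    {s : Finset A} {t : Finset B} {f : A → B} (h : s.image f = t) (hc : s.card = t.card + 1) :
    ∃ x ∈ s, ∃ y ∈ s, x ≠ y ∧ f x = f y ∧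
      ∀ z ∈ s, ∀ w ∈ s, z ≠ w → f z = f w → (z = x ∧ w = y) ∨ (z = y ∧ w = x) := by
  obtain ⟨x, hx, y, hy, hxy, hf⟩ :=
    Finset.exists_ne_map_eq_of_card_lt_of_maps_to (s := s) (t := t) (f := f) (by omega)
      (fun a ha => by rw [← h]; exact Finset.mem_coe.2 (Finset.mem_image_of_mem f ha))
  have key : ∀ x ∈ s, ∀ y ∈ s, x ≠ y → f x = f y → Set.InjOn f (s.erase x) := by
    intro x hx y hy hxy hf
    apply Finset.injOn_of_card_image_eq
    have : (s.erase x).image f = t := by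
      rw [← h]
      ext b
      simp only [Finset.mem_image, Finset.mem_erase]
      constructor
      · rintro ⟨a, ⟨-, ha⟩, rfl⟩
        exact ⟨a, ha, rfl⟩
      · rintro ⟨a, ha, rfl⟩
        by_cases hax : a = x
        · exact ⟨y, ⟨hxy.symm, hy⟩, by rw [hax, hf]⟩
        · exact ⟨a, ⟨hax, ha⟩, rfl⟩
    rw [this, Finset.card_erase_of_mem hx, hc]
    rfl
  refine ⟨x, hx, y, hy, hxy, hf, fun z hz w hw hzw hfz => ?_⟩
  have k1 := key x hx y hy hxy hf
  have k2 := key y hy x hx hxy.symm hf.symm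
  have h1 : z = x ∨ w = x := by
    by_contra! hcon
    exact hzw (k1 (by simp [hcon.1, hz]) (by simp [hcon.2, hw]) hfz)
  have h2 : z = y ∨ w = y := by
    by_contra! hcon
    exact hzw (k2 (by simp [hcon.1, hz]) (by simp [hcon.2, hw]) hfz)
  rcases h1 with h1 | h1 <;> rcases h2 with h2 | h2
  · exact absurd (h1.symm.trans h2) hxy
  · exact Or.inl ⟨h1, h2⟩
  · exact Or.inr ⟨h2, h1⟩
  · exact absurd (h1.symm.trans h2) hxy

variable {I X α : Type*} [LinearOrder α]

/-- `S` is dominant for the family of rankings `r` if no point of `X` is, in every ranking, above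
the lowest-ranked point of `S`. -/
def Dominant (r : I → X → α) (S : Finset X) : Prop :=
  ∀ x, ∃ i, ∀ s ∈ S, r i x ≤ r i s

theorem Dominant.mono {r : I → X → α} {S T : Finset X} (h : Dominant r S) (hT : T ⊆ S) :
    Dominant r T := fun x => (h x).imp fun _ hi s hs => hi s (hT hs)

/-- The points `e i` are slack points for the rankings `r`, which are strict: ranking `i` puts the
slack point `e i` below all other points, and the other slack points above all points that are not
slack points. -/
structure IsSlack (r : I → X → α) (e : I → X) : Prop where
  rank_inj : ∀ i, Function.Injective (r i)
  inj : Function.Injective e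
  lt_of_ne : ∀ i x, x ≠ e i → r i (e i) < r i x
  lt_slack : ∀ i j x, j ≠ i → x ∉ Set.range e → r i x < r i (e j)

variable [Fintype I] [DecidableEq I] [Fintype X] [DecidableEq X]

/-- A dominant set with one point fewer than there are rankings, other than a set of slack points,
extends in exactly two ways to a dominant set with one point more: among the rankings exactly two,
`i` and `j`, have the same lowest point of `D`, and the new point is the highest one in ranking `i`
(or `j`) of those above `D`'s lowest points in all other rankings. -/
theorem exists_two_extensions {r : I → X → α} {e : I → X} (hs : IsSlack r e) {D : Finset X}
    (hD : Dominant r D) (hcard : D.card + 1 = Fintype.card I) (hne : D.Nonempty)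
    (hex : ∃ x ∈ D, x ∉ Set.range e) :
    ∃ x y, x ≠ y ∧ x ∉ D ∧ y ∉ D ∧ ∀ z, z ∉ D →
      (Dominant r (insert z D) ↔ z = x ∨ z = y) := by
  have hmin : ∀ i, ∃ s ∈ D, ∀ t ∈ D, r i s ≤ r i t := fun i => D.exists_min_image (r i) hne
  choose mn mnD mnle using hmin
  have himg : Finset.univ.image mn = D := by
    ext s
    simp only [Finset.mem_image, Finset.mem_univ, true_and]
    constructor
    · rintro ⟨i, rfl⟩; exact mnD i
    · intro hsD
      obtain ⟨i, hi⟩ := hD s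
      exact ⟨i, hs.rank_inj i (le_antisymm (mnle i s hsD) (hi _ (mnD i)))⟩
  obtain ⟨i, -, j, -, hij, hmn, huniq⟩ := exists_unique_collision himg
    (by rw [hcard]; rfl)
  have huniq' : ∀ k l, k ≠ l → mn k = mn l → (k = i ∧ l = j) ∨ (k = j ∧ l = i) :=
    fun k l => huniq k (Finset.mem_univ _) l (Finset.mem_univ _)
  -- no point lies above all the minima
  have hno : ∀ t, ∃ k, r k t ≤ r k (mn k) := fun t => by
    obtain ⟨k, hk⟩ := hD t
    exact ⟨k, hk _ (mnD k)⟩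
  obtain ⟨x0, hx0D, hx0⟩ := hex
  -- the highest point among those above all the minima but the `i`-th
  have hmax : ∀ i, ∃ x, (∀ k, k ≠ i → r k (mn k) < r k x) ∧
      ∀ t, (∀ k, k ≠ i → r k (mn k) < r k t) → r i t ≤ r i x := by
    intro i
    obtain ⟨x, hx, hxm⟩ := (Finset.univ.filter fun x =>
        ∀ k, k ≠ i → r k (mn k) < r k x).exists_max_image (r i) ⟨e i, by
        simp only [Finset.mem_filter, Finset.mem_univ, true_and]
        intro k hk
        exact (mnle k x0 hx0D).trans_lt (hs.lt_slack k i x0 hk.symm hx0)⟩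
    simp only [Finset.mem_filter, Finset.mem_univ, true_and] at hx hxm
    exact ⟨x, hx, hxm⟩
  -- such a point extends `D`
  have hext : ∀ i j, i ≠ j → mn i = mn j → ∀ x, (∀ k, k ≠ i → r k (mn k) < r k x) →
      (∀ t, (∀ k, k ≠ i → r k (mn k) < r k t) → r i t ≤ r i x) →
      x ∉ D ∧ Dominant r (insert x D) := by
    intro i j hij hmn x hx hxm
    constructor
    · intro hxD
      rw [← himg] at hxD
      obtain ⟨k, -, rfl⟩ := Finset.mem_image.1 hxD
      by_cases hki : k = i
      · subst hki
        have := hx j hij.symm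
        rw [hmn] at this
        exact lt_irrefl _ this
      · exact lt_irrefl _ (hx k hki)
    · intro t
      by_cases ht : ∀ k, k ≠ i → r k (mn k) < r k t
      · refine ⟨i, fun s hsS => ?_⟩
        rcases Finset.mem_insert.1 hsS with rfl | hsD
        · exact hxm t ht
        · refine le_trans ?_ (mnle i s hsD)
          obtain ⟨k, hk⟩ := hno t
          by_cases hki : k = i
          · exact hki ▸ hk
          · exact absurd hk (not_le.2 (ht k hki))
      · push Not at ht
        obtain ⟨k, hki, hk⟩ := ht
        refine ⟨k, fun s hsS => ?_⟩
        rcases Finset.mem_insert.1 hsS with rfl | hsD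
        · exact hk.trans (hx k hki).le
        · exact hk.trans (mnle k s hsD)
  obtain ⟨x, hx, hxm⟩ := hmax i
  obtain ⟨y, hy, hym⟩ := hmax j
  obtain ⟨hxD, hxd⟩ := hext i j hij hmn x hx hxm
  obtain ⟨hyD, hyd⟩ := hext j i hij.symm hmn.symm y hy hym
  refine ⟨x, y, ?_, hxD, hyD, fun z hz => ⟨fun hzd => ?_, ?_⟩⟩
  · rintro rfl
    obtain ⟨k, hk⟩ := hno x
    by_cases hki : k = i
    · exact absurd hk (not_le.2 (hy k (hki ▸ hij)))
    · exact absurd hk (not_le.2 (hx k hki))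
  · -- a new point lies below the minimum in ranking `i` or in ranking `j`, and in no other
    have hback : ∀ k, r k z < r k (mn k) →
        ∃ l, l ≠ k ∧ mn l = mn k ∧ r l (mn l) < r l z := by
      intro k hk
      obtain ⟨l, hl⟩ := hzd (mn k)
      have h1 : mn l = mn k := hs.rank_inj l
        (le_antisymm (mnle l _ (mnD k)) (hl _ (Finset.mem_insert_of_mem (mnD l))))
      have h2 : r l (mn l) < r l z := by
        rw [h1]
        refine lt_of_le_of_ne (hl z (Finset.mem_insert_self _ _)) fun h => hz ?_
        rw [← hs.rank_inj l h]
        exact mnD k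
      refine ⟨l, ?_, h1, h2⟩
      rintro rfl
      exact lt_asymm hk h2
    have hlt : ∀ k, r k z ≠ r k (mn k) := fun k h => hz (hs.rank_inj k h ▸ mnD k)
    have hfin : ∀ i j, (∀ k l, k ≠ l → mn k = mn l → (k = i ∧ l = j) ∨ (k = j ∧ l = i)) →
        ∀ x, (∀ k, k ≠ i → r k (mn k) < r k x) →
        (∀ t, (∀ k, k ≠ i → r k (mn k) < r k t) → r i t ≤ r i x) →
        x ∉ D → r i z < r i (mn i) → z = x := by
      intro i j huniq' x hx hxm hxD hzi
      have hzM : ∀ k, k ≠ i → r k (mn k) < r k z := by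
        intro k hki
        by_contra hcon
        have hk : r k z < r k (mn k) := lt_of_le_of_ne (not_lt.1 hcon) (hlt k)
        obtain ⟨l, hlk, hl, hlz⟩ := hback k hk
        rcases huniq' l k hlk hl with h | h
        · rw [h.1] at hlz
          exact lt_asymm hlz hzi
        · exact hki h.2
      refine hs.rank_inj i (le_antisymm (hxm z hzM) ?_)
      obtain ⟨k, hk⟩ := hzd x
      by_cases hki : k = i
      · exact hki ▸ hk z (Finset.mem_insert_self _ _)
      · exact absurd (hk _ (Finset.mem_insert_of_mem (mnD k))) (not_le.2 (hx k hki))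
    obtain ⟨k, hk⟩ := hzd z
    have hkz : r k z < r k (mn k) :=
      lt_of_le_of_ne (hk _ (Finset.mem_insert_of_mem (mnD k))) (hlt k)
    obtain ⟨l, hlk, hl, -⟩ := hback k hkz
    rcases huniq' l k hlk hl with h | h
    · right
      refine hfin j i (fun a b hab h => (huniq' a b hab h).symm) y hy hym hyD ?_
      rw [← h.2]; exact hkz
    · left
      refine hfin i j huniq' x hx hxm hxD ?_
      rw [← h.2]; exact hkz
  · rintro (rfl | rfl)
    · exact hxd
    · exact hyd

/-- The slack points other than `e i` extend in exactly one way to a dominant set, namely by the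
highest non-slack point in ranking `i`. -/
theorem exists_unique_extension_slack {r : I → X → α} {e : I → X} (hs : IsSlack r e)
    (hX : ∃ x, x ∉ Set.range e) (i : I) :
    Dominant r ((Finset.univ.erase i).image e) ∧
    ∃ x, x ∉ (Finset.univ.erase i).image e ∧ ∀ z, z ∉ (Finset.univ.erase i).image e →
      (Dominant r (insert z ((Finset.univ.erase i).image e)) ↔ z = x) := by
  classical
  obtain ⟨x0, hx0⟩ := hX
  obtain ⟨x, hx, hxm⟩ := (Finset.univ.filter fun x => x ∉ Set.range e).exists_max_image
    (r i) ⟨x0, by simpa using hx0⟩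
  simp only [Finset.mem_filter, Finset.mem_univ, true_and] at hx hxm
  have hmem : ∀ z, z ∈ (Finset.univ.erase i).image e ↔ ∃ k, k ≠ i ∧ e k = z := by
    intro z; simp
  have hxd : Dominant r (insert x ((Finset.univ.erase i).image e)) := by
    intro t
    by_cases ht : t ∈ Set.range e
    · obtain ⟨k, rfl⟩ := ht
      refine ⟨k, fun s _ => ?_⟩
      by_cases hsk : s = e k
      · rw [hsk]
      · exact (hs.lt_of_ne k s hsk).le
    · refine ⟨i, fun s hsS => ?_⟩
      rcases Finset.mem_insert.1 hsS with rfl | hsD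
      · exact hxm t ht
      · obtain ⟨k, hk, rfl⟩ := (hmem s).1 hsD
        exact (hs.lt_slack i k t hk ht).le
  refine ⟨hxd.mono (Finset.subset_insert _ _), x, ?_, fun z hz => ⟨fun hzd => ?_, ?_⟩⟩
  · intro h
    obtain ⟨k, -, hk⟩ := (hmem x).1 h
    exact hx ⟨k, hk⟩
  · have key : ∀ t, t ∉ Set.range e → r i t ≤ r i z := by
      intro t ht
      obtain ⟨k, hk⟩ := hzd t
      by_cases hki : k = i
      · exact hki ▸ hk z (Finset.mem_insert_self _ _)
      · refine absurd (hk (e k) (Finset.mem_insert_of_mem ((hmem _).2 ⟨k, hki, rfl⟩))) ?_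
        exact not_le.2 (hs.lt_of_ne k t fun h => ht ⟨k, h.symm⟩)
    have hzr : z ∉ Set.range e := by
      rintro ⟨k, rfl⟩
      by_cases hki : k = i
      · subst hki
        exact absurd (key x hx) (not_le.2 (hs.lt_of_ne k x fun h => hx ⟨k, h.symm⟩))
      · exact hz ((hmem _).2 ⟨k, hki, rfl⟩)
    exact hs.rank_inj i (le_antisymm (hxm z hzr) (key x hx))
  · rintro rfl; exact hxd

/-- A dominant set on which the colouring `c` takes every colour exactly once exists. The pairs
`D ⊆ S` of dominant sets in which `D` carries every colour but `i₀` once and `S` has one point more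
are counted in two ways. A set `D` lies in two sets `S`, except for the set of slack points, which
lies in one. A set `S` contains an even number of sets `D` unless it carries all colours. -/
theorem exists_colorful_dominant {r : I → X → α} {e : I → X} (hs : IsSlack r e)
    (hX : ∃ x, x ∉ Set.range e) (hI : 2 ≤ Fintype.card I) {c : X → I} (hc : ∀ i, c (e i) = i) :
    ∃ S : Finset X, Dominant r S ∧ S.card = Fintype.card I ∧ S.image c = Finset.univ := by
  classical
  by_contra hcon
  push Not at hcon
  have : Nonempty I := Fintype.card_pos_iff.1 (by omega)
  obtain ⟨i₀⟩ := this
  set rooms : Finset (Finset X) :=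
    Finset.univ.filter fun S => Dominant r S ∧ S.card = Fintype.card I with hrooms
  set doors : Finset (Finset X) :=
    Finset.univ.filter fun D => Dominant r D ∧ D.card + 1 = Fintype.card I ∧
      D.image c = Finset.univ.erase i₀ with hdoors
  set D₀ : Finset X := (Finset.univ.erase i₀).image e with hD₀
  have hcount := Finset.sum_card_bipartiteAbove_eq_sum_card_bipartiteBelow
    (s := doors) (t := rooms) (fun D S => D ⊆ S)
  -- a door lies in two rooms, `D₀` in one
  have hroom_iff : ∀ D ∈ doors, ∀ S, (S ∈ rooms ∧ D ⊆ S) ↔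
      ∃ z, z ∉ D ∧ Dominant r (insert z D) ∧ S = insert z D := by
    intro D hD S
    simp only [hdoors, hrooms, Finset.mem_filter, Finset.mem_univ, true_and] at hD ⊢
    constructor
    · rintro ⟨⟨h1, h2⟩, h3⟩
      have hcd : (S \ D).card = 1 := by
        rw [Finset.card_sdiff_of_subset h3]; omega
      obtain ⟨z, hz⟩ := Finset.card_eq_one.1 hcd
      have hzS : z ∉ D := by
        have : z ∈ S \ D := by rw [hz]; simp
        exact (Finset.mem_sdiff.1 this).2
      have hSe : S = insert z D := by
        rw [← Finset.sdiff_union_of_subset h3, hz]; rfl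
      exact ⟨z, hzS, hSe ▸ h1, hSe⟩
    · rintro ⟨z, hz, hd, rfl⟩
      refine ⟨⟨hd, ?_⟩, Finset.subset_insert _ _⟩
      rw [Finset.card_insert_of_notMem hz]; exact hD.2.1
  have hD₀mem : D₀ ∈ doors := by
    simp only [hdoors, Finset.mem_filter, Finset.mem_univ, true_and]
    refine ⟨(exists_unique_extension_slack hs hX i₀).1, ?_, ?_⟩
    · rw [hD₀, Finset.card_image_of_injective _ hs.inj,
        Finset.card_erase_of_mem (Finset.mem_univ _), Finset.card_univ]
      omega
    · rw [hD₀, Finset.image_image]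
      have : c ∘ e = id := funext hc
      rw [this, Finset.image_id]
  have habove₀ : (Finset.bipartiteAbove (fun D S => D ⊆ S) rooms D₀).card = 1 := by
    obtain ⟨-, x, hx, hiff⟩ := exists_unique_extension_slack hs hX i₀
    rw [Finset.card_eq_one]
    refine ⟨insert x D₀, ?_⟩
    ext S
    rw [Finset.bipartiteAbove, Finset.mem_filter, hroom_iff D₀ hD₀mem, Finset.mem_singleton]
    constructor
    · rintro ⟨z, hz, hd, rfl⟩
      rw [(hiff z hz).1 hd]
    · rintro rfl
      exact ⟨x, hx, (hiff x hx).2 rfl, rfl⟩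
  have habove : ∀ D ∈ doors, D ≠ D₀ →
      (Finset.bipartiteAbove (fun D S => D ⊆ S) rooms D).card = 2 := by
    intro D hD hne
    have hD' := hD
    simp only [hdoors, Finset.mem_filter, Finset.mem_univ, true_and] at hD'
    have hex : ∃ x ∈ D, x ∉ Set.range e := by
      by_contra! hall
      apply hne
      rw [hD₀, ← hD'.2.2, Finset.image_image]
      ext x
      simp only [Finset.mem_image, Function.comp]
      constructor
      · intro hx
        obtain ⟨k, rfl⟩ := hall x hx
        exact ⟨_, hx, by rw [hc]⟩
      · rintro ⟨y, hy, rfl⟩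
        obtain ⟨k, rfl⟩ := hall y hy
        rwa [hc]
    obtain ⟨x, y, hxy, hx, hy, hiff⟩ := exists_two_extensions hs hD'.1 hD'.2.1
      (by rw [← Finset.card_pos]; omega) hex
    rw [Finset.card_eq_two]
    refine ⟨insert x D, insert y D, ?_, ?_⟩
    · intro h
      have : x ∈ insert y D := h ▸ Finset.mem_insert_self x D
      rcases Finset.mem_insert.1 this with h | h
      · exact hxy h
      · exact hx h
    · ext S
      rw [Finset.bipartiteAbove, Finset.mem_filter, hroom_iff D hD, Finset.mem_insert,
        Finset.mem_singleton]
      constructor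
      · rintro ⟨z, hz, hd, rfl⟩
        rcases (hiff z hz).1 hd with rfl | rfl
        · exact Or.inl rfl
        · exact Or.inr rfl
      · rintro (rfl | rfl)
        · exact ⟨x, hx, (hiff x hx).2 (Or.inl rfl), rfl⟩
        · exact ⟨y, hy, (hiff y hy).2 (Or.inr rfl), rfl⟩
  -- a room that is not colourful has no door or two
  have hbelow : ∀ S ∈ rooms,
      Even (Finset.bipartiteBelow (fun D S => D ⊆ S) doors S).card := by
    intro S hS
    simp only [hrooms, Finset.mem_filter, Finset.mem_univ, true_and] at hS
    have hdoor_iff : ∀ D, (D ∈ doors ∧ D ⊆ S) ↔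
        ∃ z ∈ S, (S.erase z).image c = Finset.univ.erase i₀ ∧ D = S.erase z := by
      intro D
      simp only [hdoors, Finset.mem_filter, Finset.mem_univ, true_and]
      constructor
      · rintro ⟨⟨h1, h2, h3⟩, h4⟩
        have hcd : (S \ D).card = 1 := by
          rw [Finset.card_sdiff_of_subset h4]; omega
        obtain ⟨z, hz⟩ := Finset.card_eq_one.1 hcd
        have hzS : z ∈ S \ D := by rw [hz]; simp
        have hDe : D = S.erase z := by
          rw [← Finset.sdiff_singleton_eq_erase, ← hz, Finset.sdiff_sdiff_eq_self h4]
        exact ⟨z, (Finset.mem_sdiff.1 hzS).1, hDe ▸ h3, hDe⟩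
      · rintro ⟨z, hz, himg, rfl⟩
        refine ⟨⟨hS.1.mono (Finset.erase_subset _ _), ?_, himg⟩, Finset.erase_subset _ _⟩
        rw [Finset.card_erase_of_mem hz]; omega
    by_cases himg : S.image c = Finset.univ.erase i₀
    · obtain ⟨x, hx, y, hy, hxy, hfxy, huniq⟩ := exists_unique_collision himg (by
        rw [hS.2, Finset.card_erase_of_mem (Finset.mem_univ _), Finset.card_univ]; omega)
      have herase : ∀ x ∈ S, ∀ y ∈ S, x ≠ y → c x = c y →
          (S.erase x).image c = Finset.univ.erase i₀ := by
        intro x hx y hy hxy hfxy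
        rw [← himg]
        refine (Finset.image_subset_image (Finset.erase_subset _ _)).antisymm ?_
        intro k hk
        obtain ⟨z, hz, rfl⟩ := Finset.mem_image.1 hk
        by_cases hzx : z = x
        · exact Finset.mem_image.2 ⟨y, Finset.mem_erase.2 ⟨hxy.symm, hy⟩, by rw [hzx, hfxy]⟩
        · exact Finset.mem_image.2 ⟨z, Finset.mem_erase.2 ⟨hzx, hz⟩, rfl⟩
      suffices h : (Finset.bipartiteBelow (fun D S => D ⊆ S) doors S).card = 2 by
        rw [h]; exact even_two
      rw [Finset.card_eq_two]
      refine ⟨S.erase x, S.erase y, ?_, ?_⟩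
      · intro h
        have : y ∈ S.erase x := Finset.mem_erase.2 ⟨hxy.symm, hy⟩
        rw [h] at this
        exact (Finset.mem_erase.1 this).1 rfl
      · ext D
        rw [Finset.bipartiteBelow, Finset.mem_filter, hdoor_iff, Finset.mem_insert,
          Finset.mem_singleton]
        constructor
        · rintro ⟨z, hz, hzi, rfl⟩
          have hcz : c z ∈ (S.erase z).image c := by
            rw [hzi, ← himg]; exact Finset.mem_image_of_mem c hz
          obtain ⟨w, hw, hwz⟩ := Finset.mem_image.1 hcz
          rcases huniq z hz w (Finset.mem_erase.1 hw).2 (Finset.mem_erase.1 hw).1.symm hwz.symm with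
            h | h
          · left; rw [h.1]
          · right; rw [h.1]
        · rintro (rfl | rfl)
          · exact ⟨x, hx, herase x hx y hy hxy hfxy, rfl⟩
          · exact ⟨y, hy, herase y hy x hx hxy.symm hfxy.symm, rfl⟩
    · suffices h : Finset.bipartiteBelow (fun D S => D ⊆ S) doors S = ∅ by
        rw [h]; simp
      rw [Finset.eq_empty_iff_forall_notMem]
      intro D hD
      rw [Finset.bipartiteBelow, Finset.mem_filter, hdoor_iff] at hD
      obtain ⟨z, hz, hzi, rfl⟩ := hD
      have hSi : S.image c = insert (c z) (Finset.univ.erase i₀) := by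
        rw [← hzi, ← Finset.image_insert, Finset.insert_erase hz]
      by_cases hcz : c z = i₀
      · apply hcon S hS.1 hS.2
        rw [hSi, hcz, Finset.insert_erase (Finset.mem_univ _)]
      · apply himg
        rw [hSi, Finset.insert_eq_of_mem (Finset.mem_erase.2 ⟨hcz, Finset.mem_univ _⟩)]
  have heven : Even (∑ S ∈ rooms, (Finset.bipartiteBelow (fun D S => D ⊆ S) doors S).card) :=
    Finset.even_sum _ hbelow
  rw [← hcount, ← Finset.add_sum_erase _ _ hD₀mem, habove₀, Nat.even_add] at heven
  have : Even (∑ D ∈ doors.erase D₀, (Finset.bipartiteAbove (fun D S => D ⊆ S) rooms D).card) :=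
    Finset.even_sum _ fun D hD => by
      rw [habove D (Finset.mem_erase.1 hD).2 (Finset.mem_erase.1 hD).1]; exact even_two
  exact Nat.not_even_one (heven.2 this)

end FirstPrice

/-! ### Brouwer's fixed point theorem on the simplex -/

namespace FirstPrice

open Filter Topology

/-- Sperner's lemma for the grid of integer points of sum `M`: if the points are coloured by their
coordinates, there are points at bounded distance from each other such that the `i`-th one has
colour `i` unless its `i`-th coordinate is small. The grid, with slack points added, is ranked by
each coordinate; a colourful dominant set provides the points. -/
theorem exists_close_grid_points {I : Type*} [Fintype I] [DecidableEq I]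
    (hI : 2 ≤ Fintype.card I) (M : ℕ) (c : (I → ℕ) → I) :
    ∃ y : I → I → ℕ, (∀ i, ∑ k, y i k = M) ∧
      (∀ i j k, y i k ≤ y j k + Fintype.card I) ∧
      ∀ i, c (y i) = i ∨ y i i ≤ Fintype.card I := by
  classical
  have : Nonempty I := Fintype.card_pos_iff.1 (by omega)
  let T := {t : I → ℕ // t ∈ Finset.piAntidiag Finset.univ M}
  have memT : ∀ t : I → ℕ, t ∈ Finset.piAntidiag Finset.univ M ↔ ∑ k, t k = M := by
    intro t; simp [Finset.mem_piAntidiag]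
  let _ : Fintype T := Finset.Subtype.fintype _
  let X := T ⊕ I
  let _ : Fintype X := inferInstanceAs (Fintype (T ⊕ I))
  let w : I → X → ℤ := fun i x =>
    Sum.elim (fun t : T => (t.1 i : ℤ)) (fun j => if j = i then -1 else (M : ℤ) + 1) x
  let r : I → X → ℤ ×ₗ Fin (Fintype.card X) := fun i x => toLex (w i x, Fintype.equivFin X x)
  have hrlt : ∀ i x y, w i x < w i y → r i x < r i y := fun i x y h =>
    Prod.Lex.toLex_lt_toLex.2 (Or.inl h)
  have hrle : ∀ i x y, r i x ≤ r i y → w i x ≤ w i y := fun i x y h => by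
    by_contra hcon
    exact absurd h (not_le.2 (hrlt i y x (not_le.1 hcon)))
  have hTle : ∀ (t : T) i, t.1 i ≤ M := fun t i => by
    refine le_trans ?_ ((memT t.1).1 t.2).le
    exact Finset.single_le_sum (f := t.1) (fun _ _ => Nat.zero_le _) (Finset.mem_univ i)
  have hs : IsSlack r (Sum.inr : I → X) := by
    refine ⟨fun i x y h => ?_, Sum.inr_injective, fun i x hx => hrlt _ _ _ ?_,
      fun i j x hji hx => hrlt _ _ _ ?_⟩
    · have h2 := congrArg (fun z => (ofLex z).2) h
      exact (Fintype.equivFin X).injective h2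
    · rcases x with t | j
      · simp only [w, Sum.elim_inl, Sum.elim_inr, if_true]; omega
      · have hji : j ≠ i := fun h => hx (by rw [h])
        simp only [w, Sum.elim_inr, if_true, if_neg hji]; omega
    · rcases x with t | k
      · simp only [w, Sum.elim_inl, Sum.elim_inr, if_neg hji]
        have := hTle t i
        omega
      · exact absurd ⟨k, rfl⟩ hx
  have hT : ∃ t : I → ℕ, ∑ k, t k = M := ⟨Pi.single (Classical.arbitrary I) M, by simp⟩
  obtain ⟨t₀, ht₀⟩ := hT
  obtain ⟨S, hSd, -, hSc⟩ := exists_colorful_dominant hs ⟨Sum.inl ⟨t₀, (memT _).2 ht₀⟩, by simp⟩ hI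
    (c := Sum.elim (fun t : T => c t.1) id) (fun i => rfl)
  -- the coordinates whose slack point is not used
  let C : Finset I := Finset.univ.filter fun i => (Sum.inr i : X) ∉ S
  have hmemC : ∀ i, i ∈ C ↔ (Sum.inr i : X) ∉ S := fun i => by simp [C]
  have hdom : ∀ t : T, ∃ i ∈ C, ∀ s : T, (Sum.inl s : X) ∈ S → t.1 i ≤ s.1 i := by
    intro t
    obtain ⟨i, hi⟩ := hSd (Sum.inl t)
    refine ⟨i, (hmemC i).2 fun hiS => ?_, fun s hsS => ?_⟩
    · have := hrle _ _ _ (hi _ hiS)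
      simp only [w, Sum.elim_inl, Sum.elim_inr, if_true] at this
      omega
    · have := hrle _ _ _ (hi _ hsS)
      simpa [w] using this
  have hcol : ∀ i ∈ C, ∃ s : T, (Sum.inl s : X) ∈ S ∧ c s.1 = i := by
    intro i hi
    have : i ∈ S.image (Sum.elim (fun t : T => c t.1) id) := by rw [hSc]; exact Finset.mem_univ _
    obtain ⟨x, hxS, hx⟩ := Finset.mem_image.1 this
    rcases x with s | j
    · exact ⟨s, hxS, hx⟩
    · have hj : j = i := hx
      exact absurd (hj ▸ hxS) ((hmemC i).1 hi)
  obtain ⟨i₀, hi₀, -⟩ := hdom ⟨t₀, (memT _).2 ht₀⟩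
  obtain ⟨s₀, hs₀, -⟩ := hcol i₀ hi₀
  let σ : Finset T := Finset.univ.filter fun s => (Sum.inl s : X) ∈ S
  have hmin : ∀ i, ∃ s ∈ σ, ∀ s' ∈ σ, s.1 i ≤ s'.1 i := fun i =>
    σ.exists_min_image (fun s => s.1 i) ⟨s₀, by simpa [σ] using hs₀⟩
  choose mn hmnσ hmn using hmin
  let m : I → ℕ := fun i => (mn i).1 i
  have hm : ∀ (s : T), (Sum.inl s : X) ∈ S → ∀ i, m i ≤ s.1 i := fun s hsS i =>
    hmn i s (by simpa [σ] using hsS)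
  -- otherwise a grid point would lie above all the minima
  have hsum : M < ∑ i ∈ C, (m i + 1) := by
    by_contra! hcon
    let t : I → ℕ := fun i => (if i ∈ C then m i + 1 else 0) +
      (Pi.single i₀ (M - ∑ i ∈ C, (m i + 1)) : I → ℕ) i
    have ht : ∑ k, t k = M := by
      simp only [t, Finset.sum_add_distrib, Finset.sum_ite_mem, Finset.univ_inter,
        Finset.sum_pi_single', Finset.mem_univ, if_true]
      simp only [Finset.sum_add_distrib] at hcon ⊢
      omega
    obtain ⟨i, hiC, hi⟩ := hdom ⟨t, (memT _).2 ht⟩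
    have h1 := hi (mn i) (by simpa [σ] using hmnσ i)
    have h2 : m i + 1 ≤ t i := by simp only [t, if_pos hiC]; omega
    have h3 : t i ≤ m i := h1
    omega
  have hCcard : C.card ≤ Fintype.card I := Finset.card_le_univ C
  rw [Finset.sum_add_distrib, Finset.sum_const, smul_eq_mul, mul_one] at hsum
  have hin : ∀ s : T, (Sum.inl s : X) ∈ S → ∀ k ∈ C, s.1 k ≤ m k + Fintype.card I := by
    intro s hsS k hk
    have h1 : ∑ i ∈ C, s.1 i ≤ M := by
      refine le_trans ?_ ((memT s.1).1 s.2).le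
      exact Finset.sum_le_sum_of_subset (Finset.subset_univ _)
    rw [← Finset.add_sum_erase _ _ hk] at h1 hsum
    have h2 : ∑ i ∈ C.erase k, m i ≤ ∑ i ∈ C.erase k, s.1 i :=
      Finset.sum_le_sum fun i _ => hm s hsS i
    omega
  have hout : ∀ s : T, (Sum.inl s : X) ∈ S → ∀ k ∉ C, s.1 k ≤ Fintype.card I := by
    intro s hsS k hk
    have h1 : s.1 k + ∑ i ∈ C, s.1 i ≤ M := by
      rw [← Finset.sum_insert hk]
      refine le_trans ?_ ((memT s.1).1 s.2).le
      exact Finset.sum_le_sum_of_subset (Finset.subset_univ _)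
    have h2 : ∑ i ∈ C, m i ≤ ∑ i ∈ C, s.1 i :=
      Finset.sum_le_sum fun i _ => hm s hsS i
    omega
  have hy : ∀ i, ∃ s : T, (Sum.inl s : X) ∈ S ∧ (i ∈ C → c s.1 = i) := by
    intro i
    by_cases hi : i ∈ C
    · obtain ⟨s, h1, h2⟩ := hcol i hi
      exact ⟨s, h1, fun _ => h2⟩
    · exact ⟨s₀, hs₀, fun h => absurd h hi⟩
  choose y hyS hyc using hy
  refine ⟨fun i => (y i).1, fun i => (memT _).1 (y i).2, fun i j k => ?_, fun i => ?_⟩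
  · beta_reduce
    by_cases hk : k ∈ C
    · have h1 := hin (y i) (hyS i) k hk
      have h2 := hm (y j) (hyS j) k
      omega
    · have h1 := hout (y i) (hyS i) k hk
      omega
  · by_cases hi : i ∈ C
    · exact Or.inl (hyc i hi)
    · exact Or.inr (hout (y i) (hyS i) i hi)

/-- **Brouwer's fixed point theorem** for the standard simplex. A grid point `t` is coloured by a
coordinate that `f` does not decrease, and a limit of the points of `exists_close_grid_points` has
no coordinate that `f` decreases. -/
theorem exists_fixedPoint_stdSimplex {I : Type*} [Fintype I] [Nonempty I]
    {f : stdSimplex ℝ I → stdSimplex ℝ I} (hf : Continuous f) : ∃ x, f x = x := by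
  classical
  have hle : ∀ x y : stdSimplex ℝ I, (∀ i, x.1 i ≤ y.1 i) → y = x := by
    intro x y h
    have hsum : ∑ i, x.1 i = ∑ i, y.1 i := by rw [x.2.2, y.2.2]
    have := (Finset.sum_eq_sum_iff_of_le fun i _ => h i).1 hsum
    exact Subtype.ext (funext fun i => (this i (Finset.mem_univ i)).symm)
  rcases Nat.lt_or_ge (Fintype.card I) 2 with hI | hI
  · have hsub : Subsingleton I := Fintype.card_le_one_iff_subsingleton.1 (by omega)
    obtain ⟨i⟩ := ‹Nonempty I›
    refine ⟨⟨Pi.single i 1, single_mem_stdSimplex ℝ i⟩, hle _ _ fun j => ?_⟩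
    have hi : ∀ x : stdSimplex ℝ I, x.1 j = 1 := fun x => by
      have := x.2.2
      rwa [Fintype.sum_subsingleton _ j] at this
    rw [hi, hi]
  have hcol : ∀ x : stdSimplex ℝ I, ∃ i, x.1 i ≤ (f x).1 i := by
    intro x
    by_contra! hcon
    have : ∑ i, (f x).1 i < ∑ i, x.1 i :=
      Finset.sum_lt_sum_of_nonempty Finset.univ_nonempty fun i _ => hcon i
    rw [x.2.2, (f x).2.2] at this
    exact lt_irrefl _ this
  choose col hcol using hcol
  set N : ℝ := ((Fintype.card I : ℕ) : ℝ) with hN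
  have happrox : ∀ M : ℕ, ∃ y : I → stdSimplex ℝ I,
      (∀ i j, dist (y i) (y j) ≤ N * (1 / ((M : ℝ) + 1))) ∧
      ∀ i, (y i).1 i ≤ (f (y i)).1 i + N * (1 / ((M : ℝ) + 1)) := by
    intro M
    have hM : (0 : ℝ) < (M : ℝ) + 1 := by positivity
    let sc : (I → ℕ) → (I → ℝ) := fun t i => (t i : ℝ) / ((M : ℝ) + 1)
    have hsc : ∀ t : I → ℕ, ∑ k, t k = M + 1 → sc t ∈ stdSimplex ℝ I := by
      intro t ht
      refine ⟨fun i => by positivity, ?_⟩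
      rw [← Finset.sum_div, ← Nat.cast_sum, ht]
      push_cast
      exact div_self hM.ne'
    obtain ⟨y, hysum, hyclose, hycol⟩ := exists_close_grid_points hI (M + 1)
      (fun t => if h : sc t ∈ stdSimplex ℝ I then col ⟨sc t, h⟩ else Classical.arbitrary I)
    refine ⟨fun i => ⟨sc (y i), hsc _ (hysum i)⟩, fun i j => ?_, fun i => ?_⟩
    · rw [Subtype.dist_eq, dist_pi_le_iff (by positivity)]
      intro k
      have h1 : (y i k : ℝ) ≤ y j k + N := by rw [hN]; exact_mod_cast hyclose i j k
      have h2 : (y j k : ℝ) ≤ y i k + N := by rw [hN]; exact_mod_cast hyclose j i k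
      rw [Real.dist_eq]
      simp only [sc]
      rw [← sub_div, abs_div, abs_of_pos hM, mul_one_div]
      exact div_le_div_of_nonneg_right (abs_le.2 ⟨by linarith, by linarith⟩) hM.le
    · have hpos : 0 ≤ N * (1 / ((M : ℝ) + 1)) := by positivity
      rcases hycol i with h | h
      · rw [dif_pos (hsc _ (hysum i))] at h
        have := hcol ⟨sc (y i), hsc _ (hysum i)⟩
        rw [h] at this
        linarith
      · have h1 : (y i i : ℝ) ≤ N := by rw [hN]; exact_mod_cast h
        have h2 : sc (y i) i ≤ N * (1 / ((M : ℝ) + 1)) := by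
          rw [mul_one_div]
          exact div_le_div_of_nonneg_right h1 hM.le
        have h3 := (f ⟨sc (y i), hsc _ (hysum i)⟩).2.1 i
        change sc (y i) i ≤ _
        linarith
  choose y hyd hyf using happrox
  obtain ⟨i₀⟩ := ‹Nonempty I›
  have : CompactSpace (stdSimplex ℝ I) := isCompact_iff_compactSpace.1 (isCompact_stdSimplex ℝ I)
  obtain ⟨x, -, φ, hφ, hx⟩ := isCompact_univ.tendsto_subseq (x := fun M => y M i₀)
    fun _ => Set.mem_univ _
  have hzero : Tendsto (fun M => N * (1 / (((φ M : ℕ) : ℝ) + 1))) atTop (𝓝 0) := by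
    have := (tendsto_one_div_add_atTop_nhds_zero_nat (𝕜 := ℝ)).comp hφ.tendsto_atTop
    simpa using this.const_mul N
  have hlim : ∀ i, Tendsto (fun M => y (φ M) i) atTop (𝓝 x) := by
    intro i
    refine tendsto_of_tendsto_of_dist hx ?_
    exact squeeze_zero (fun _ => dist_nonneg) (fun M => hyd _ _ _) hzero
  refine ⟨x, hle _ _ fun i => ?_⟩
  have hev : Continuous fun z : stdSimplex ℝ I => z.1 i :=
    (continuous_apply i).comp continuous_subtype_val
  have h1 := (hev.tendsto x).comp (hlim i)
  have h2 := (((hev.comp hf).tendsto x).comp (hlim i)).add hzero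
  rw [add_zero] at h2
  exact le_of_tendsto_of_tendsto' h1 h2 fun M => hyf _ i

/-! ### A minimax inequality -/

/-- A form of **Ky Fan's minimax inequality**. The gain `φ d x` of a deviation `d` against `x` is
continuous in `x`, and the points of `X` can be mixed along finitely many deviations so that the
mixture does not gain against itself on average. Then some `x` admits no gainful deviation. -/
theorem exists_forall_nonpos {X D : Type*} [TopologicalSpace X] [CompactSpace X] [Nonempty X]
    (φ : D → X → ℝ) (hφ : ∀ d, Continuous (φ d))
    (hmix : ∀ s : Finset D, s.Nonempty → ∃ ψ : stdSimplex ℝ s → X, Continuous ψ ∧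
      ∀ l : stdSimplex ℝ s, ∑ a, l.1 a * φ a (ψ l) ≤ 0) :
    ∃ x, ∀ d, φ d x ≤ 0 := by
  classical
  have hfin : ∀ s : Finset D, ∃ x, ∀ d ∈ s, φ d x ≤ 0 := by
    intro s
    rcases s.eq_empty_or_nonempty with rfl | hs
    · exact ⟨Classical.arbitrary X, by simp⟩
    obtain ⟨ψ, hψ, hle⟩ := hmix s hs
    have : Nonempty s := hs.to_subtype
    -- the map of the simplex that shifts weight to the gainful deviations
    let g : stdSimplex ℝ s → s → ℝ := fun l a => max (φ a (ψ l)) 0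
    have hg : ∀ a, Continuous fun l => g l a := fun a =>
      ((hφ a).comp hψ).max continuous_const
    have hg0 : ∀ l a, 0 ≤ g l a := fun l a => le_max_right _ _
    have hG0 : ∀ l, 0 ≤ ∑ a, g l a := fun l => Finset.sum_nonneg fun a _ => hg0 l a
    have hpos : ∀ l, 0 < 1 + ∑ a, g l a := fun l => by linarith [hG0 l]
    have hmem : ∀ l : stdSimplex ℝ s,
        (fun a => (l.1 a + g l a) / (1 + ∑ a, g l a)) ∈ stdSimplex ℝ s := by
      intro l
      refine ⟨fun a => div_nonneg (add_nonneg (l.2.1 a) (hg0 l a)) (hpos l).le, ?_⟩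
      rw [← Finset.sum_div, Finset.sum_add_distrib, l.2.2]
      exact div_self (hpos l).ne'
    have hcont : Continuous fun l : stdSimplex ℝ s =>
        (⟨_, hmem l⟩ : stdSimplex ℝ s) := by
      refine Continuous.subtype_mk (continuous_pi fun a => ?_) _
      refine Continuous.div ?_ (continuous_const.add (continuous_finsetSum _ fun a _ => hg a))
        fun l => (hpos l).ne'
      exact ((continuous_apply a).comp continuous_subtype_val).add (hg a)
    obtain ⟨l, hl⟩ := exists_fixedPoint_stdSimplex hcont
    have hfix : ∀ a, g l a = l.1 a * ∑ a, g l a := by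
      intro a
      have h := congrFun (congrArg Subtype.val hl) a
      rw [div_eq_iff (hpos l).ne'] at h
      linarith
    -- at a fixed point every deviation of positive weight is gainful, or none is
    have hsum : ∑ a, g l a = 0 := by
      by_contra hne
      have hG : 0 < ∑ a, g l a := lt_of_le_of_ne (hG0 l) (Ne.symm hne)
      have hterm : ∀ a, l.1 a * φ a (ψ l) = l.1 a * g l a := by
        intro a
        rcases (l.2.1 a).eq_or_lt with h0 | h0
        · rw [← h0]; simp
        · have h1 : 0 < g l a := by rw [hfix a]; exact mul_pos h0 hG
          have h2 : g l a = φ a (ψ l) := by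
            rcases max_choice (φ a (ψ l)) 0 with h | h
            · exact h
            · exact absurd h h1.ne'
          rw [h2]
      have h1 := hle l
      rw [Finset.sum_congr rfl fun a _ => hterm a] at h1
      have h2 := (Finset.sum_eq_zero_iff_of_nonneg fun a _ =>
        mul_nonneg (l.2.1 a) (hg0 l a)).1 (le_antisymm h1
          (Finset.sum_nonneg fun a _ => mul_nonneg (l.2.1 a) (hg0 l a)))
      apply hne
      refine Finset.sum_eq_zero fun a ha => ?_
      have h3 := h2 a ha
      rcases mul_eq_zero.1 h3 with h | h
      · rw [hfix a, h, zero_mul]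
      · exact h
    refine ⟨ψ l, fun d hd => ?_⟩
    have := (Finset.sum_eq_zero_iff_of_nonneg fun a _ => hg0 l a).1 hsum ⟨d, hd⟩
      (Finset.mem_univ _)
    exact (le_max_left _ _).trans this.le
  have hne : (⋂ d, {x | φ d x ≤ 0}).Nonempty := by
    refine CompactSpace.iInter_nonempty (fun d => isClosed_le (hφ d) continuous_const) fun s => ?_
    obtain ⟨x, hx⟩ := hfin s
    exact ⟨x, by simpa using hx⟩
  obtain ⟨x, hx⟩ := hne
  exact ⟨x, fun d => by simpa using Set.mem_iInter.1 hx d⟩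

end FirstPrice

/-! ### The joint law of values and bids -/

namespace DiscreteAuction

open Filter Topology

variable {n : ℕ} (A : DiscreteAuction n)

/-- An upper bound on all the values. -/
noncomputable def maxValue : ℝ := ∑ i, ∑ j, A.v i j

theorem le_maxValue (i : Fin n) (j : Fin (A.d i)) : A.v i j ≤ A.maxValue :=
  (Finset.single_le_sum (f := A.v i) (fun j _ => A.v_nonneg i j) (Finset.mem_univ j)).trans
    (Finset.single_le_sum (f := fun i => ∑ j, A.v i j)
      (fun i _ => Finset.sum_nonneg fun j _ => A.v_nonneg i j) (Finset.mem_univ i))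

theorem maxValue_nonneg : 0 ≤ A.maxValue :=
  Finset.sum_nonneg fun i _ => Finset.sum_nonneg fun j _ => A.v_nonneg i j

/-- The joint law of the values and bids of all buyers. -/
noncomputable abbrev jointLaw (σ : A.Strategy) : Measure (Fin n → ℝ × ℝ) :=
  Measure.pi (A.valueBidLaw σ)

theorem ae_bid_of_ae_valueBidLaw {σ : A.Strategy} {k : Fin n} {P : ℝ × ℝ → Prop}
    (h : ∀ᵐ z ∂A.valueBidLaw σ k, P z) (j : Fin (A.d k)) :
    ∀ᵐ x ∂(σ.bid k j : Measure ℝ), P (A.v k j, x) := by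
  have hac : (σ.bid k j : Measure ℝ).map (fun x => (A.v k j, x)) ≪ A.valueBidLaw σ k := by
    intro s hs
    simp only [valueBidLaw, Measure.coe_finsetSum, Finset.sum_apply, Measure.smul_apply,
      smul_eq_mul, Finset.sum_eq_zero_iff, Finset.mem_univ, true_implies] at hs
    rcases mul_eq_zero.1 (hs j) with h0 | h0
    · exact absurd h0 (ENNReal.ofReal_pos.2 (A.p_pos k j)).ne'
    · exact h0
  exact ae_of_ae_map (f := fun x => (A.v k j, x)) (by fun_prop) (hac.ae_le h)

theorem ae_valueBidLaw {σ : A.Strategy} {k : Fin n} {P : ℝ × ℝ → Prop}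
    (hP : MeasurableSet {z | P z})
    (h : ∀ j, ∀ᵐ x ∂(σ.bid k j : Measure ℝ), P (A.v k j, x)) :
    ∀ᵐ z ∂A.valueBidLaw σ k, P z := by
  rw [ae_iff]
  simp only [valueBidLaw, Measure.coe_finsetSum, Finset.sum_apply, Measure.smul_apply,
    smul_eq_mul, Finset.sum_eq_zero_iff, Finset.mem_univ, true_implies]
  intro j
  have := (ae_map_iff (f := fun x => (A.v k j, x)) (by fun_prop) hP).2 (h j)
  rw [ae_iff.1 this, mul_zero]

theorem integral_valueBidLaw {σ : A.Strategy} {k : Fin n} {f : ℝ × ℝ → ℝ}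
    (hf : StronglyMeasurable f) (hint : Integrable f (A.valueBidLaw σ k)) :
    ∫ z, f z ∂A.valueBidLaw σ k = ∑ j, A.p k j * ∫ x, f (A.v k j, x) ∂(σ.bid k j : Measure ℝ) := by
  rw [valueBidLaw] at hint ⊢
  rw [integral_finsetSum_measure (integrable_finsetSum_measure.1 hint)]
  refine Finset.sum_congr rfl fun j _ => ?_
  rw [integral_smul_measure, integral_map (by fun_prop) hf.aestronglyMeasurable,
    ENNReal.toReal_ofReal (A.p_pos k j).le, smul_eq_mul]

/-- Resampling one coordinate independently leaves a product measure unchanged. -/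
theorem measurePreserving_update_pi {ι : Type*} [Fintype ι] [DecidableEq ι] {α : ι → Type*}
    [∀ i, MeasurableSpace (α i)] (ν : ∀ i, Measure (α i)) [∀ i, IsProbabilityMeasure (ν i)]
    (i : ι) :
    MeasurePreserving (fun q : α i × (∀ i, α i) => Function.update q.2 i q.1)
      ((ν i).prod (Measure.pi ν)) (Measure.pi ν) := by
  have hm : Measurable fun q : α i × (∀ i, α i) => Function.update q.2 i q.1 := by
    refine measurable_pi_iff.2 fun k => ?_
    by_cases hk : k = i
    · subst hk; simpa using measurable_fst
    · simp only [Function.update_of_ne hk]; fun_prop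
  refine ⟨hm, (Measure.pi_eq fun s hs => ?_).symm⟩
  rw [Measure.map_apply hm (MeasurableSet.univ_pi hs)]
  have hpre : (fun q : α i × (∀ i, α i) => Function.update q.2 i q.1) ⁻¹' Set.univ.pi s =
      s i ×ˢ Set.univ.pi (Function.update s i Set.univ) := by
    ext q
    simp only [Set.mem_preimage, Set.mem_pi, Set.mem_univ, true_implies, Set.mem_prod]
    constructor
    · intro h
      refine ⟨by simpa using h i, fun k => ?_⟩
      by_cases hk : k = i
      · subst hk; simp
      · simpa [hk] using h k
    · rintro ⟨h1, h2⟩ k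
      by_cases hk : k = i
      · subst hk; simpa using h1
      · simpa [hk] using h2 k
  rw [hpre, Measure.prod_prod, Measure.pi_pi, ← Finset.mul_prod_erase _ _ (Finset.mem_univ i),
    ← Finset.mul_prod_erase _ (fun i => ν i (s i)) (Finset.mem_univ i)]
  simp only [Function.update_self, measure_univ, one_mul]
  congr 1
  refine Finset.prod_congr rfl fun k hk => ?_
  rw [Function.update_of_ne (Finset.ne_of_mem_erase hk)]

/-- Conditioning an almost sure event on the value and the bid of buyer `i`. -/
theorem ae_ae_update {σ : A.Strategy} {P : (Fin n → ℝ × ℝ) → Prop}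
    (h : ∀ᵐ ω ∂A.jointLaw σ, P ω) (i : Fin n) (j : Fin (A.d i)) :
    ∀ᵐ y ∂(σ.bid i j : Measure ℝ), ∀ᵐ ω ∂A.jointLaw σ, P (Function.update ω i (A.v i j, y)) :=
  A.ae_bid_of_ae_valueBidLaw (Measure.ae_ae_of_ae_prod
    ((measurePreserving_update_pi (A.valueBidLaw σ) i).quasiMeasurePreserving.ae h)) j

/-- Conditioning an expectation on the value and the bid of buyer `i`. -/
theorem integral_jointLaw {σ : A.Strategy} {F : (Fin n → ℝ × ℝ) → ℝ} (hF : Measurable F)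
    (hint : Integrable F (A.jointLaw σ)) (i : Fin n) :
    ∫ ω, F ω ∂A.jointLaw σ = ∑ j, A.p i j *
      ∫ y, ∫ ω, F (Function.update ω i (A.v i j, y)) ∂A.jointLaw σ ∂(σ.bid i j : Measure ℝ) := by
  have hmp := measurePreserving_update_pi (A.valueBidLaw σ) i
  have hint' : Integrable (fun q : (ℝ × ℝ) × (Fin n → ℝ × ℝ) => F (Function.update q.2 i q.1))
      ((A.valueBidLaw σ i).prod (A.jointLaw σ)) := hmp.integrable_comp_of_integrable hint
  have hmap := integral_map (μ := (A.valueBidLaw σ i).prod (A.jointLaw σ))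
    hmp.measurable.aemeasurable (f := F) hF.aestronglyMeasurable
  rw [hmp.map_eq] at hmap
  refine (hmap.trans (integral_prod _ hint')).trans ?_
  exact A.integral_valueBidLaw
    (StronglyMeasurable.integral_prod_right' (hF.comp hmp.measurable).stronglyMeasurable)
    hint'.integral_prod_left

/-- The almost sure properties of a profile of values and bids: nobody overbids and the values are
bounded. -/
def Sound (ω : Fin n → ℝ × ℝ) : Prop :=
  ∀ k, 0 ≤ (ω k).2 ∧ (ω k).2 ≤ (ω k).1 ∧ (ω k).1 ≤ A.maxValue

theorem ae_sound (σ : A.Strategy) : ∀ᵐ ω ∂A.jointLaw σ, A.Sound ω := by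
  refine ae_all_iff.2 fun k => ?_
  have h : ∀ᵐ z ∂A.valueBidLaw σ k, 0 ≤ z.2 ∧ z.2 ≤ z.1 ∧ z.1 ≤ A.maxValue := by
    refine A.ae_valueBidLaw ?_ fun j => ?_
    · exact (measurableSet_le measurable_const measurable_snd).inter
        ((measurableSet_le measurable_snd measurable_fst).inter
          (measurableSet_le measurable_fst measurable_const))
    · filter_upwards [σ.bid_mem k j] with x hx
      exact ⟨hx.1, hx.2, A.le_maxValue k j⟩
  exact (measurePreserving_eval (A.valueBidLaw σ) k).quasiMeasurePreserving.ae h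

/-! ### Gains and surplus -/

/-- The surplus `v i - b i` of buyer `i` if all other bids are related to his own by `R`, and
`0` otherwise. For `R = (· ≤ ·)` this is his utility if he wins all ties at his bid, and for
`R = (· < ·)` his utility if he loses them. -/
noncomputable def gain (R : ℝ → ℝ → Prop) (i : Fin n) (ω : Fin n → ℝ × ℝ) : ℝ :=
  open Classical in if ∀ k, k ≠ i → R (ω k).2 (ω i).2 then (ω i).1 - (ω i).2 else 0

variable {A} {R : ℝ → ℝ → Prop}

theorem gain_update {i : Fin n} {ω : Fin n → ℝ × ℝ} {a x : ℝ} :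
    gain R i (Function.update ω i (a, x)) =
      open Classical in if ∀ k, k ≠ i → R (ω k).2 x then a - x else 0 := by
  have h : (∀ k, k ≠ i → R (Function.update ω i (a, x) k).2 (Function.update ω i (a, x) i).2) ↔
      ∀ k, k ≠ i → R (ω k).2 x := by
    refine forall₂_congr fun k hk => ?_
    rw [Function.update_of_ne hk, Function.update_self]
  unfold gain
  by_cases hc : ∀ k, k ≠ i → R (ω k).2 x
  · rw [if_pos (h.2 hc), if_pos hc, Function.update_self]
  · rw [if_neg (mt h.1 hc), if_neg hc]

theorem measurable_gain (hR : MeasurableSet {z : ℝ × ℝ | R z.1 z.2}) (i : Fin n) :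
    Measurable (gain R i) := by
  classical
  unfold gain
  refine Measurable.ite ?_ (by fun_prop) measurable_const
  have : {ω : Fin n → ℝ × ℝ | ∀ k, k ≠ i → R (ω k).2 (ω i).2} =
      ⋂ k, ⋂ (_ : k ≠ i), {ω | R (ω k).2 (ω i).2} := by
    ext ω; simp
  rw [this]
  refine MeasurableSet.iInter fun k => MeasurableSet.iInter fun _ => ?_
  exact (show Measurable fun ω : Fin n → ℝ × ℝ => ((ω k).2, (ω i).2) by fun_prop) hR

theorem Sound.gain_mem {ω : Fin n → ℝ × ℝ} (h : A.Sound ω) (R : ℝ → ℝ → Prop) (i : Fin n) :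
    gain R i ω ∈ Set.Icc 0 A.maxValue := by
  obtain ⟨h0, h1, h2⟩ := h i
  unfold gain
  split_ifs
  · exact ⟨by linarith, by linarith⟩
  · exact ⟨le_rfl, A.maxValue_nonneg⟩

theorem integrable_gain (hR : MeasurableSet {z : ℝ × ℝ | R z.1 z.2}) (σ : A.Strategy)
    (i : Fin n) : Integrable (gain R i) (A.jointLaw σ) := by
  refine Integrable.of_bound (measurable_gain hR i).aestronglyMeasurable A.maxValue ?_
  filter_upwards [A.ae_sound σ] with ω hω
  have := hω.gain_mem R i
  rw [Real.norm_of_nonneg this.1]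
  exact this.2

theorem integrable_gain_update (hR : MeasurableSet {z : ℝ × ℝ | R z.1 z.2}) (σ : A.Strategy)
    (i : Fin n) (a x : ℝ) :
    Integrable (fun ω => gain R i (Function.update ω i (a, x))) (A.jointLaw σ) := by
  refine Integrable.of_bound (C := |a - x|) ?_ ?_
  · refine ((measurable_gain hR i).comp ?_).aestronglyMeasurable
    exact (measurePreserving_update_pi (A.valueBidLaw σ) i).measurable.comp
      (measurable_const.prodMk measurable_id)
  · refine Eventually.of_forall fun ω => ?_
    rw [gain_update]
    split_ifs
    · exact le_rfl
    · simp

variable (A) in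
/-- The expected gain of buyer `i` with value `v i j` who bids `x` while the others follow `σ`. -/
noncomputable def interimGain (R : ℝ → ℝ → Prop) (σ : A.Strategy) (i : Fin n)
    (j : Fin (A.d i)) (x : ℝ) : ℝ :=
  ∫ ω, gain R i (Function.update ω i (A.v i j, x)) ∂A.jointLaw σ

theorem sum_integral_gain (hR : MeasurableSet {z : ℝ × ℝ | R z.1 z.2}) (σ : A.Strategy) :
    ∫ ω, ∑ i, gain R i ω ∂A.jointLaw σ =
      ∑ i, ∑ j, A.p i j * ∫ x, A.interimGain R σ i j x ∂(σ.bid i j : Measure ℝ) := by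
  rw [integral_finsetSum _ fun i _ => integrable_gain hR σ i]
  exact Finset.sum_congr rfl fun i _ =>
    A.integral_jointLaw (measurable_gain hR i) (integrable_gain hR σ i) i

theorem interimGain_nonneg (σ : A.Strategy) (i : Fin n) (j : Fin (A.d i)) {x : ℝ}
    (hx : x ≤ A.v i j) : 0 ≤ A.interimGain R σ i j x := by
  refine integral_nonneg fun ω => ?_
  rw [gain_update]
  split_ifs
  · simpa using hx
  · exact le_rfl

theorem interimGain_le (hR : MeasurableSet {z : ℝ × ℝ | R z.1 z.2}) (σ : A.Strategy) (i : Fin n)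
    (j : Fin (A.d i)) {x : ℝ} (hx : x ≤ A.v i j) : A.interimGain R σ i j x ≤ A.v i j - x := by
  have : A.interimGain R σ i j x ≤ ∫ _, (A.v i j - x) ∂A.jointLaw σ := by
    refine integral_mono (integrable_gain_update hR σ i _ _) (integrable_const _) fun ω => ?_
    change gain R i _ ≤ _
    rw [gain_update]
    split_ifs
    · exact le_rfl
    · linarith
  simpa using this

theorem integrable_interimGain (hR : MeasurableSet {z : ℝ × ℝ | R z.1 z.2}) (σ : A.Strategy)
    (i : Fin n) (j : Fin (A.d i)) :
    Integrable (A.interimGain R σ i j) (σ.bid i j : Measure ℝ) := by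
  refine Integrable.of_bound (C := A.v i j) ?_ ?_
  · have h := (measurable_gain hR i).comp
      (measurePreserving_update_pi (A.valueBidLaw σ) i).measurable
    have h' : StronglyMeasurable fun z : ℝ × ℝ =>
        ∫ ω, gain R i (Function.update ω i z) ∂A.jointLaw σ :=
      StronglyMeasurable.integral_prod_right' h.stronglyMeasurable
    exact (h'.comp_measurable (measurable_const.prodMk measurable_id)).aestronglyMeasurable
  · filter_upwards [σ.bid_mem i j] with x hx
    rw [Real.norm_of_nonneg (interimGain_nonneg σ i j hx.2)]
    exact (interimGain_le hR σ i j hx.2).trans (by linarith [hx.1])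

/-- The interim gain at some admissible bid is at least the average one. -/
theorem exists_integral_interimGain_le (hR : MeasurableSet {z : ℝ × ℝ | R z.1 z.2})
    (σ : A.Strategy) (i : Fin n) (j : Fin (A.d i)) :
    ∃ x ∈ Set.Icc 0 (A.v i j),
      ∫ y, A.interimGain R σ i j y ∂(σ.bid i j : Measure ℝ) ≤ A.interimGain R σ i j x := by
  obtain ⟨x, hx, hle⟩ := exists_notMem_null_integral_le (integrable_interimGain hR σ i j)
    (ae_iff.1 (σ.bid_mem i j))
  exact ⟨x, by simpa using hx, hle⟩

/-- The largest surplus `v i - b i` among the highest bidders (and `0` in the absence of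
buyers). -/
noncomputable def surplus (ω : Fin n → ℝ × ℝ) : ℝ :=
  (highestBidders fun k => (ω k).2).fold max 0 fun i => (ω i).1 - (ω i).2

variable (A) in
/-- A continuous function that is almost surely above the surplus and tends to it as `m` grows:
buyers who are not among the highest bidders are penalised by `m` times the amounts by which they
are outbid. The cap at `maxValue`, which no surplus of a sound profile exceeds, makes it bounded. -/
noncomputable def relaxedSurplus (m : ℕ) (ω : Fin n → ℝ × ℝ) : ℝ :=
  min A.maxValue (Finset.univ.fold max 0 fun i =>
    (ω i).1 - (ω i).2 - m * ∑ k, max ((ω k).2 - (ω i).2) 0)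

theorem continuous_fold_max {ι Y : Type*} [TopologicalSpace Y] {s : Finset ι} {f : ι → Y → ℝ}
    (hf : ∀ i, Continuous (f i)) : Continuous fun y => s.fold max 0 fun i => f i y := by
  classical
  induction s using Finset.induction_on with
  | empty => simpa using continuous_const
  | insert a s ha ih =>
    simp only [Finset.fold_insert ha]
    exact (hf a).max ih

theorem continuous_relaxedSurplus (m : ℕ) : Continuous (A.relaxedSurplus m) := by
  refine continuous_const.min (continuous_fold_max fun i => ?_)
  fun_prop

theorem relaxedSurplus_mem (m : ℕ) (ω : Fin n → ℝ × ℝ) :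
    A.relaxedSurplus m ω ∈ Set.Icc 0 A.maxValue :=
  ⟨le_min A.maxValue_nonneg (Finset.le_fold_max _ |>.2 (Or.inl le_rfl)), min_le_left _ _⟩

theorem integrable_relaxedSurplus (m : ℕ) (σ : A.Strategy) :
    Integrable (A.relaxedSurplus m) (A.jointLaw σ) := by
  refine Integrable.of_bound (continuous_relaxedSurplus m).measurable.aestronglyMeasurable
    A.maxValue (Eventually.of_forall fun ω => ?_)
  rw [Real.norm_of_nonneg (relaxedSurplus_mem m ω).1]
  exact (relaxedSurplus_mem m ω).2

theorem mem_highestBidders {b : Fin n → ℝ} {i : Fin n} :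
    i ∈ highestBidders b ↔ ∀ k, b k ≤ b i := by
  simp [highestBidders]

/-- At most one buyer outbids all others, and his surplus is not penalised. -/
theorem Sound.sum_gain_lt_le {ω : Fin n → ℝ × ℝ} (h : A.Sound ω) (m : ℕ) :
    ∑ i, gain (· < ·) i ω ≤ A.relaxedSurplus m ω := by
  by_cases hex : ∃ i, ∀ k, k ≠ i → (ω k).2 < (ω i).2
  · obtain ⟨i, hi⟩ := hex
    have hsum : ∑ k, gain (· < ·) k ω = (ω i).1 - (ω i).2 := by
      rw [Finset.sum_eq_single i]
      · rw [gain, if_pos hi]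
      · intro k _ hk
        rw [gain, if_neg]
        exact fun hcon => lt_asymm (hi k hk) (hcon i hk.symm)
      · simp
    rw [hsum]
    obtain ⟨h0, h1, h2⟩ := h i
    refine le_min (by linarith) (Finset.le_fold_max _ |>.2 (Or.inr ⟨i, Finset.mem_univ i, ?_⟩))
    have : ∑ k, max ((ω k).2 - (ω i).2) 0 = 0 := by
      refine Finset.sum_eq_zero fun k _ => max_eq_right ?_
      by_cases hk : k = i
      · rw [hk, sub_self]
      · linarith [hi k hk]
    rw [this, mul_zero, sub_zero]
  · push Not at hex
    have hsum : ∑ k, gain (· < ·) k ω = 0 := by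
      refine Finset.sum_eq_zero fun k _ => ?_
      rw [gain, if_neg]
      obtain ⟨l, hl, hle⟩ := hex k
      exact fun hcon => absurd (hcon l hl) (not_lt.2 hle)
    rw [hsum]
    exact (relaxedSurplus_mem m ω).1

theorem Sound.tendsto_relaxedSurplus {ω : Fin n → ℝ × ℝ} (h : A.Sound ω) :
    Tendsto (fun m => A.relaxedSurplus m ω) atTop (𝓝 (surplus ω)) := by
  -- for large `m` only the highest bidders have a positive penalised surplus
  have hev : ∀ i, ∀ᶠ m : ℕ in atTop, i ∉ highestBidders (fun k => (ω k).2) →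
      (ω i).1 - (ω i).2 - m * ∑ k, max ((ω k).2 - (ω i).2) 0 ≤ 0 := by
    intro i
    by_cases hi : i ∈ highestBidders fun k => (ω k).2
    · exact Eventually.of_forall fun m hcon => absurd hi hcon
    · rw [mem_highestBidders] at hi
      push Not at hi
      obtain ⟨k, hk⟩ := hi
      have hpos : 0 < ∑ k, max ((ω k).2 - (ω i).2) 0 :=
        Finset.sum_pos' (fun _ _ => le_max_right _ _)
          ⟨k, Finset.mem_univ k, lt_max_of_lt_left (by linarith)⟩
      have := (tendsto_natCast_atTop_atTop (R := ℝ)).atTop_mul_const hpos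
      filter_upwards [this.eventually_ge_atTop ((ω i).1 - (ω i).2)] with m hm _
      linarith
  refine tendsto_const_nhds.congr' ?_
  filter_upwards [eventually_all.2 hev] with m hm
  have hpen : ∀ i ∈ highestBidders (fun k => (ω k).2),
      (ω i).1 - (ω i).2 - m * ∑ k, max ((ω k).2 - (ω i).2) 0 = (ω i).1 - (ω i).2 := by
    intro i hi
    rw [mem_highestBidders] at hi
    have : ∑ k, max ((ω k).2 - (ω i).2) 0 = 0 :=
      Finset.sum_eq_zero fun k _ => max_eq_right (by linarith [hi k])
    rw [this, mul_zero, sub_zero]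
  have hfold : (Finset.univ.fold max 0 fun i =>
      (ω i).1 - (ω i).2 - m * ∑ k, max ((ω k).2 - (ω i).2) 0) = surplus ω := by
    refine le_antisymm (Finset.fold_max_le _ |>.2 ⟨Finset.le_fold_max _ |>.2 (Or.inl le_rfl),
      fun i _ => ?_⟩) (Finset.fold_max_le _ |>.2 ⟨Finset.le_fold_max _ |>.2 (Or.inl le_rfl),
      fun i hi => ?_⟩)
    · by_cases hi : i ∈ highestBidders fun k => (ω k).2
      · rw [hpen i hi]
        exact Finset.le_fold_max _ |>.2 (Or.inr ⟨i, hi, le_rfl⟩)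
      · exact (hm i hi).trans (Finset.le_fold_max _ |>.2 (Or.inl le_rfl))
    · exact Finset.le_fold_max _ |>.2 (Or.inr ⟨i, Finset.mem_univ i, (hpen i hi).ge⟩)
  have hle : surplus ω ≤ A.maxValue :=
    Finset.fold_max_le _ |>.2 ⟨A.maxValue_nonneg, fun i _ => by
      obtain ⟨h0, -, h2⟩ := h i
      linarith⟩
  rw [relaxedSurplus, hfold, min_eq_right hle]

theorem surplus_nonneg (ω : Fin n → ℝ × ℝ) : 0 ≤ surplus ω :=
  Finset.le_fold_max _ |>.2 (Or.inl le_rfl)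

theorem Sound.surplus_le {ω : Fin n → ℝ × ℝ} (h : A.Sound ω) : surplus ω ≤ A.maxValue :=
  le_of_tendsto' h.tendsto_relaxedSurplus fun m => (relaxedSurplus_mem m ω).2

theorem integrable_surplus (σ : A.Strategy) : Integrable surplus (A.jointLaw σ) := by
  refine Integrable.of_bound (C := A.maxValue) ?_ ?_
  · refine aestronglyMeasurable_of_tendsto_ae atTop (f := A.relaxedSurplus)
      (fun m => (continuous_relaxedSurplus m).measurable.aestronglyMeasurable) ?_
    filter_upwards [A.ae_sound σ] with ω hω using hω.tendsto_relaxedSurplus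
  · filter_upwards [A.ae_sound σ] with ω hω
    rw [Real.norm_of_nonneg (surplus_nonneg ω)]
    exact hω.surplus_le

theorem tendsto_integral_relaxedSurplus (σ : A.Strategy) :
    Tendsto (fun m => ∫ ω, A.relaxedSurplus m ω ∂A.jointLaw σ) atTop
      (𝓝 (∫ ω, surplus ω ∂A.jointLaw σ)) := by
  refine tendsto_integral_of_dominated_convergence (fun _ => A.maxValue)
    (fun m => (continuous_relaxedSurplus m).measurable.aestronglyMeasurable)
    (integrable_const _) (fun m => Eventually.of_forall fun ω => ?_) ?_
  · rw [Real.norm_of_nonneg (relaxedSurplus_mem m ω).1]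
    exact (relaxedSurplus_mem m ω).2
  · filter_upwards [A.ae_sound σ] with ω hω using hω.tendsto_relaxedSurplus

theorem gain_le_eq (i : Fin n) (ω : Fin n → ℝ × ℝ) :
    gain (· ≤ ·) i ω =
      if i ∈ highestBidders fun k => (ω k).2 then (ω i).1 - (ω i).2 else 0 := by
  have : (∀ k, k ≠ i → (ω k).2 ≤ (ω i).2) ↔ i ∈ highestBidders fun k => (ω k).2 := by
    rw [mem_highestBidders]
    refine forall_congr' fun k => ⟨fun h => ?_, fun h _ => h⟩
    by_cases hk : k = i
    · rw [hk]
    · exact h hk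
  simp only [gain, this]

/-- The largest surplus is one of the surpluses of the highest bidders, all of which are
nonnegative. -/
theorem Sound.surplus_le_sum_gain {ω : Fin n → ℝ × ℝ} (h : A.Sound ω) :
    surplus ω ≤ ∑ i, gain (· ≤ ·) i ω := by
  have h0 : ∀ i ∈ Finset.univ, 0 ≤ gain (· ≤ ·) i ω := fun i _ => (h.gain_mem _ i).1
  refine Finset.fold_max_le _ |>.2 ⟨Finset.sum_nonneg h0, fun i hi => ?_⟩
  refine le_trans ?_ (Finset.single_le_sum h0 (Finset.mem_univ i))
  rw [gain_le_eq, if_pos hi]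

theorem le_price (v b : Fin n → ℝ) (i : Fin n) : b i ≤ price v b i :=
  Finset.le_fold_max _ |>.2 (Or.inl le_rfl)

/-- If the gains of the tied buyers add up to no more than their largest surplus, at most one of
them has a positive surplus, and the Vickrey tie-break gives him the item at the tied bid. -/
theorem Sound.utility_eq {ω : Fin n → ℝ × ℝ} (h : A.Sound ω)
    (hsum : ∑ i, gain (· ≤ ·) i ω ≤ surplus ω) (i : Fin n) :
    utility (fun k => (ω k).1) (fun k => (ω k).2) i = gain (· ≤ ·) i ω := by
  set H := highestBidders fun k => (ω k).2 with hH
  have h0 : ∀ i, 0 ≤ gain (· ≤ ·) i ω := fun i => (h.gain_mem _ i).1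
  have hgain : ∀ i ∈ H, gain (· ≤ ·) i ω = (ω i).1 - (ω i).2 := fun i hi => by
    rw [gain_le_eq, if_pos hi]
  -- at most one of the highest bidders has a positive surplus
  have hpair : ∀ i ∈ H, ∀ k ∈ H, i ≠ k → (ω i).2 < (ω i).1 → (ω k).1 = (ω k).2 := by
    intro i hi k hk hik hlt
    by_contra hne
    have hk' : (ω k).2 < (ω k).1 := lt_of_le_of_ne (h k).2.1 (Ne.symm hne)
    have htwo : ∀ l l', l ≠ l' → gain (· ≤ ·) l ω + gain (· ≤ ·) l' ω ≤ surplus ω := by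
      intro l l' hl
      refine le_trans ?_ hsum
      rw [← Finset.sum_pair hl (f := fun l => gain (· ≤ ·) l ω)]
      exact Finset.sum_le_sum_of_subset_of_nonneg (Finset.subset_univ _) fun _ _ _ => h0 _
    have hgi : 0 < gain (· ≤ ·) i ω := by rw [hgain i hi]; linarith
    have hgk : 0 < gain (· ≤ ·) k ω := by rw [hgain k hk]; linarith
    have hlt' : surplus ω < surplus ω := by
      refine Finset.fold_max_lt _ |>.2 ⟨by linarith [htwo i k hik], fun l hl => ?_⟩
      rw [← hgain l hl]
      by_cases hli : l = i
      · subst hli; linarith [htwo l k hik]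
      · linarith [htwo l i hli]
    exact lt_irrefl _ hlt'
  have hbid : ∀ i ∈ H, ∀ k ∈ H, (ω i).2 = (ω k).2 := fun i hi k hk =>
    le_antisymm (mem_highestBidders.1 hk i) (mem_highestBidders.1 hi k)
  have hwin : ∀ {i}, i ∈ winners (fun k => (ω k).1) (fun k => (ω k).2) ↔
      i ∈ H ∧ ∀ k ∈ H, (ω k).1 ≤ (ω i).1 := by
    intro i; simp [winners, hH]
  unfold utility
  split_ifs with hi
  · obtain ⟨hiH, himax⟩ := hwin.1 hi
    rw [hgain i hiH]
    have hother : ∀ k ∈ H, k ≠ i → (ω k).1 = (ω i).2 := by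
      intro k hk hki
      rw [hbid i hiH k hk]
      by_contra hne
      have hlt : (ω k).2 < (ω k).1 := lt_of_le_of_ne (h k).2.1 (Ne.symm hne)
      have h1 := hpair k hk i hiH hki hlt
      have h2 := himax k hk
      rw [hbid k hk i hiH] at hlt
      linarith
    have hprice : price (fun k => (ω k).1) (fun k => (ω k).2) i = (ω i).2 := by
      refine le_antisymm (Finset.fold_max_le _ |>.2 ⟨le_rfl, fun k hk => ?_⟩) 
        (le_price (fun k => (ω k).1) (fun k => (ω k).2) i)
      exact (hother k (Finset.mem_of_mem_erase hk) (Finset.ne_of_mem_erase hk)).le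
    rw [hprice]
    rcases (h i).2.1.eq_or_lt with heq | hlt
    · simp only [heq, sub_self, zero_div]
    · have hcard : winners (fun k => (ω k).1) (fun k => (ω k).2) = {i} := by
        ext k
        rw [Finset.mem_singleton]
        refine ⟨fun hk => ?_, fun hk => hk ▸ hi⟩
        by_contra hki
        obtain ⟨hkH, hkmax⟩ := hwin.1 hk
        have h1 := hother k hkH hki
        have h2 := hkmax i hiH
        linarith
      rw [hcard]
      simp
  · by_cases hiH : i ∈ H
    · rw [hgain i hiH]
      have : ∃ k ∈ H, (ω i).1 < (ω k).1 := by
        by_contra! hcon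
        exact hi (hwin.2 ⟨hiH, hcon⟩)
      obtain ⟨k, hk, hlt⟩ := this
      have hki : k ≠ i := by rintro rfl; exact lt_irrefl _ hlt
      have h1 := (h i).2.1
      have h2 := hbid i hiH k hk
      rw [hpair k hk i hiH hki (by linarith), sub_self]
    · rw [gain_le_eq, if_neg hiH]

/-- A buyer who does not overbid cannot do better than to win all ties at his bid. -/
theorem utility_update_le {v b : Fin n → ℝ} {i : Fin n} (hb : b i ≤ v i) :
    utility v b i ≤ gain (· ≤ ·) i fun k => (v k, b k) := by
  rw [gain_le_eq]
  unfold utility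
  split_ifs with hi hH hH
  · have hcard : (1 : ℝ) ≤ (winners v b).card := by
      exact_mod_cast Finset.card_pos.2 ⟨i, hi⟩
    have hp := le_price v b i
    rw [div_le_iff₀ (by linarith)]
    change v i - price v b i ≤ (v i - b i) * _
    nlinarith
  · exact absurd (Finset.mem_filter.1 hi).1 hH
  · simpa using hb
  · exact le_rfl

theorem utility_nonpos {v b : Fin n → ℝ} {i : Fin n} (hb : v i ≤ b i) : utility v b i ≤ 0 := by
  unfold utility
  split_ifs
  · exact div_nonpos_of_nonpos_of_nonneg (by linarith [le_price v b i]) (Nat.cast_nonneg _)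
  · exact le_rfl

/-- Every deviation is dominated by an admissible bid at which the buyer wins all ties. -/
theorem exists_interimUtility_le (σ : A.Strategy) (i : Fin n) (j : Fin (A.d i)) {x : ℝ}
    (hx : 0 ≤ x) :
    ∃ y ∈ Set.Icc 0 (A.v i j), A.interimUtility σ i j x ≤ A.interimGain (· ≤ ·) σ i j y := by
  rcases le_total x (A.v i j) with h | h
  · refine ⟨x, ⟨hx, h⟩, ?_⟩
    -- the integral of a non-integrable function is `0`, which the gain exceeds too
    by_cases hint : Integrable (fun ω : Fin n → ℝ × ℝ =>
        utility (Function.update (fun k => (ω k).1) i (A.v i j))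
          (Function.update (fun k => (ω k).2) i x) i) (A.jointLaw σ)
    · refine integral_mono hint (integrable_gain_update measurableSet_le' σ i _ _) fun ω => ?_
      refine (utility_update_le (by simpa using h)).trans (le_of_eq ?_)
      congr 1
      funext k
      by_cases hk : k = i
      · subst hk; simp
      · simp [hk]
    · rw [interimUtility, integral_undef hint]
      exact interimGain_nonneg σ i j h
  · refine ⟨A.v i j, ⟨A.v_nonneg i j, le_rfl⟩, le_trans ?_ (interimGain_nonneg σ i j le_rfl)⟩
    exact integral_nonpos fun ω => utility_nonpos (by simpa using h)

end DiscreteAuction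

/-! ### The compact space of strategy profiles -/

namespace DiscreteAuction

open Filter Topology
open scoped BoundedContinuousFunction

variable {n : ℕ}

/-- The strategy profiles, with the bids of buyer `i` with value `v i j` in the compact interval
`[0, v i j]`. The topology is that of weak convergence of the law of each bid. -/
abbrev BidProfile (A : DiscreteAuction n) : Type :=
  ∀ (i : Fin n) (j : Fin (A.d i)), ProbabilityMeasure (Set.Icc (0 : ℝ) (A.v i j))

variable {A : DiscreteAuction n}

/-- A strategy profile with bids in `[0, v i j]`, as a profile of laws on `ℝ`. -/
noncomputable def BidProfile.toStrategy (μ : A.BidProfile) : A.Strategy where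
  bid i j := (μ i j).map (measurable_subtype_coe (p := (· ∈ Set.Icc 0 (A.v i j)))).aemeasurable
  bid_mem i j := by
    rw [ProbabilityMeasure.toMeasure_map]
    exact (ae_map_iff measurable_subtype_coe.aemeasurable measurableSet_Icc).2
      (Eventually.of_forall fun x => x.2)

theorem BidProfile.integral_bid (μ : A.BidProfile) (i : Fin n) (j : Fin (A.d i)) (f : ℝ → ℝ) :
    ∫ x, f x ∂(μ.toStrategy.bid i j : Measure ℝ) =
      ∫ x : Set.Icc (0 : ℝ) (A.v i j), f x ∂(μ i j : Measure _) := by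
  simp only [toStrategy, ProbabilityMeasure.toMeasure_map]
  exact (MeasurableEmbedding.subtype_coe measurableSet_Icc).integral_map f

theorem BidProfile.continuous_integral_jointLaw (f : (Fin n → ℝ × ℝ) →ᵇ ℝ) :
    Continuous fun μ : A.BidProfile => ∫ ω, f ω ∂A.jointLaw μ.toStrategy := by
  let law : A.BidProfile → ∀ _ : Fin n, ProbabilityMeasure (ℝ × ℝ) :=
    fun μ k => ⟨A.valueBidLaw μ.toStrategy k, inferInstance⟩
  have hlaw : Continuous law := by
    refine continuous_pi fun k => ?_
    rw [ProbabilityMeasure.continuous_iff_forall_continuous_integral]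
    intro g
    have heq : ∀ μ : A.BidProfile, ∫ z, g z ∂(law μ k : Measure (ℝ × ℝ)) =
        ∑ j, A.p k j * ∫ x : Set.Icc (0 : ℝ) (A.v k j), g (A.v k j, x) ∂(μ k j : Measure _) := by
      intro μ
      refine (A.integral_valueBidLaw g.continuous.stronglyMeasurable (g.integrable _)).trans ?_
      exact Finset.sum_congr rfl fun j _ => by
        rw [μ.integral_bid k j fun x => g (A.v k j, x)]
    simp only [heq]
    refine continuous_finsetSum _ fun j _ => continuous_const.mul ?_
    have h1 : Continuous fun ν : ProbabilityMeasure (Set.Icc (0 : ℝ) (A.v k j)) =>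
        ∫ x, (g.compContinuous ⟨fun x : Set.Icc (0 : ℝ) (A.v k j) => (A.v k j, (x : ℝ)),
          by fun_prop⟩) x ∂(ν : Measure _) :=
      ProbabilityMeasure.continuous_integral_boundedContinuousFunction _
    exact h1.comp ((continuous_apply j).comp (continuous_apply k))
  exact (ProbabilityMeasure.continuous_integral_boundedContinuousFunction f).comp
    (ProbabilityMeasure.continuous_pi.comp hlaw)

theorem BidProfile.continuous_integral_of_bounded {f : (Fin n → ℝ × ℝ) → ℝ} (hf : Continuous f)
    (C : ℝ) (hC : ∀ ω, ‖f ω‖ ≤ C) :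
    Continuous fun μ : A.BidProfile => ∫ ω, f ω ∂A.jointLaw μ.toStrategy :=
  BidProfile.continuous_integral_jointLaw (BoundedContinuousFunction.ofNormedAddCommGroup f hf C hC)

/-- The law that takes the value `x a` with probability `l a`. -/
noncomputable def mixDirac {s E : Type*} [Fintype s] [MeasurableSpace E] (x : s → E)
    (l : stdSimplex ℝ s) : ProbabilityMeasure E :=
  ⟨∑ a, ENNReal.ofReal (l.1 a) • Measure.dirac (x a), ⟨by
    simp only [Measure.coe_finsetSum, Finset.sum_apply, Measure.smul_apply, measure_univ,
      smul_eq_mul, mul_one]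
    rw [← ENNReal.ofReal_sum_of_nonneg fun a _ => l.2.1 a, l.2.2, ENNReal.ofReal_one]⟩⟩

theorem integral_mixDirac {s E : Type*} [Fintype s] [MeasurableSpace E]
    [MeasurableSingletonClass E] (x : s → E) (l : stdSimplex ℝ s) (f : E → ℝ) :
    ∫ y, f y ∂(mixDirac x l : Measure E) = ∑ a, l.1 a * f (x a) := by
  change ∫ y, f y ∂(∑ a, ENNReal.ofReal (l.1 a) • Measure.dirac (x a)) = _
  rw [integral_finsetSum_measure fun a _ =>
    (integrable_dirac (by simp)).smul_measure ENNReal.ofReal_ne_top]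
  refine Finset.sum_congr rfl fun a _ => ?_
  rw [integral_smul_measure, integral_dirac, ENNReal.toReal_ofReal (l.2.1 a), smul_eq_mul]

theorem continuous_mixDirac {s E : Type*} [Fintype s] [MeasurableSpace E] [TopologicalSpace E]
    [OpensMeasurableSpace E] [MeasurableSingletonClass E] (x : s → E) :
    Continuous (mixDirac x) := by
  rw [ProbabilityMeasure.continuous_iff_forall_continuous_integral]
  intro f
  simp only [integral_mixDirac]
  exact continuous_finsetSum _ fun a _ =>
    ((continuous_apply a).comp continuous_subtype_val).mul continuous_const

/-! ### Continuous approximations of the gain from a deviation -/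

/-- A continuous approximation from below of the indicator function of `t > 0`. -/
noncomputable def ramp (m : ℕ) (t : ℝ) : ℝ := min 1 (((m : ℝ) + 1) * max t 0)

theorem ramp_mem (m : ℕ) (t : ℝ) : ramp m t ∈ Set.Icc (0 : ℝ) 1 :=
  ⟨le_min zero_le_one (mul_nonneg (by positivity) (le_max_right _ _)), min_le_left _ _⟩

theorem ramp_of_nonpos (m : ℕ) {t : ℝ} (ht : t ≤ 0) : ramp m t = 0 := by
  rw [ramp, max_eq_right ht, mul_zero, min_eq_right zero_le_one]

theorem ramp_of_le (m : ℕ) {t : ℝ} (ht : 1 / ((m : ℝ) + 1) ≤ t) : ramp m t = 1 := by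
  have hm : (0 : ℝ) < (m : ℝ) + 1 := by positivity
  rw [div_le_iff₀ hm] at ht
  refine min_eq_left ?_
  nlinarith [le_max_left t 0]

/-- A continuous function below the gain of buyer `i` with value `a` who bids `x` and loses all
ties. -/
noncomputable def rampGain (m : ℕ) (i : Fin n) (a x : ℝ) (ω : Fin n → ℝ × ℝ) : ℝ :=
  (a - x) * ∏ k ∈ Finset.univ.erase i, ramp m (x - (ω k).2)

theorem prod_ramp_mem (m : ℕ) (i : Fin n) (x : ℝ) (ω : Fin n → ℝ × ℝ) :
    ∏ k ∈ Finset.univ.erase i, ramp m (x - (ω k).2) ∈ Set.Icc (0 : ℝ) 1 :=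
  ⟨Finset.prod_nonneg fun _ _ => (ramp_mem m _).1,
    Finset.prod_le_one (fun _ _ => (ramp_mem m _).1) fun _ _ => (ramp_mem m _).2⟩

theorem continuous_rampGain (m : ℕ) (i : Fin n) (a x : ℝ) : Continuous (rampGain m i a x) := by
  unfold rampGain ramp
  fun_prop

theorem norm_rampGain_le (m : ℕ) (i : Fin n) (a x : ℝ) (ω : Fin n → ℝ × ℝ) :
    ‖rampGain m i a x ω‖ ≤ |a - x| := by
  obtain ⟨h0, h1⟩ := prod_ramp_mem m i x ω
  rw [rampGain, norm_mul, Real.norm_of_nonneg h0, Real.norm_eq_abs]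
  exact mul_le_of_le_one_right (abs_nonneg _) h1

theorem integrable_rampGain (σ : A.Strategy) (m : ℕ) (i : Fin n) (a x : ℝ) :
    Integrable (rampGain m i a x) (A.jointLaw σ) :=
  Integrable.of_bound (continuous_rampGain m i a x).measurable.aestronglyMeasurable |a - x|
    (Eventually.of_forall (norm_rampGain_le m i a x))

theorem rampGain_le (m : ℕ) (i : Fin n) {a x : ℝ} (hx : x ≤ a) (ω : Fin n → ℝ × ℝ) :
    rampGain m i a x ω ≤ gain (· < ·) i (Function.update ω i (a, x)) := by
  obtain ⟨h0, h1⟩ := prod_ramp_mem m i x ω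
  rw [gain_update]
  split_ifs with h
  · exact mul_le_of_le_one_right (by linarith) h1
  · push Not at h
    obtain ⟨k, hk, hle⟩ := h
    rw [rampGain, Finset.prod_eq_zero (Finset.mem_erase.2 ⟨hk, Finset.mem_univ k⟩)
      (ramp_of_nonpos m (by linarith)), mul_zero]

/-- Winning all ties at the bid `x` is hardly better than bidding slightly more than `x`. The
higher bid is capped at the value `a`. -/
theorem le_rampGain (m : ℕ) (i : Fin n) {a x : ℝ} (ω : Fin n → ℝ × ℝ) :
    gain (· ≤ ·) i (Function.update ω i (a, x)) - 1 / ((m : ℝ) + 1) ≤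
      rampGain m i a (min (x + 1 / ((m : ℝ) + 1)) a) ω := by
  have hm : (0 : ℝ) < 1 / ((m : ℝ) + 1) := by positivity
  have hnonneg : 0 ≤ rampGain m i a (min (x + 1 / ((m : ℝ) + 1)) a) ω :=
    mul_nonneg (by linarith [min_le_right (x + 1 / ((m : ℝ) + 1)) a]) (prod_ramp_mem m i _ ω).1
  rw [gain_update]
  split_ifs with h
  · rcases le_total (x + 1 / ((m : ℝ) + 1)) a with hle | hle
    · rw [min_eq_left hle, rampGain, Finset.prod_eq_one, mul_one]
      · linarith
      · intro k hk
        exact ramp_of_le m (by linarith [h k (Finset.ne_of_mem_erase hk)])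
    · linarith
  · linarith

/-! ### Existence of an equilibrium -/

/-- A profile against which no deviation gains more than the expected surplus, in the continuous
approximation. A mixture of deviations does not gain against itself, because at most one buyer
outbids all others. -/
theorem exists_rampGain_le (A : DiscreteAuction n) :
    ∃ σ : A.Strategy, ∀ (x : ∀ (i : Fin n) (j : Fin (A.d i)), Set.Icc (0 : ℝ) (A.v i j)) (m : ℕ),
      ∑ i, ∑ j, A.p i j * ∫ ω, rampGain m i (A.v i j) (x i j) ω ∂A.jointLaw σ ≤
        ∫ ω, A.relaxedSurplus m ω ∂A.jointLaw σ := by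
  let φ : ((∀ (i : Fin n) (j : Fin (A.d i)), Set.Icc (0 : ℝ) (A.v i j)) × ℕ) → A.BidProfile → ℝ :=
    fun d μ =>
      ∑ i, ∑ j, A.p i j * ∫ ω, rampGain d.2 i (A.v i j) (d.1 i j) ω ∂A.jointLaw μ.toStrategy -
        ∫ ω, A.relaxedSurplus d.2 ω ∂A.jointLaw μ.toStrategy
  have hφ : ∀ d, Continuous (φ d) := by
    intro d
    refine Continuous.sub ?_ ?_
    · exact continuous_finsetSum _ fun i _ => continuous_finsetSum _ fun j _ =>
        continuous_const.mul (BidProfile.continuous_integral_of_bounded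
          (continuous_rampGain _ _ _ _) _ (norm_rampGain_le _ _ _ _))
    · refine BidProfile.continuous_integral_of_bounded (continuous_relaxedSurplus _) A.maxValue
        fun ω => ?_
      rw [Real.norm_of_nonneg (relaxedSurplus_mem _ ω).1]
      exact (relaxedSurplus_mem _ ω).2
  have : Nonempty A.BidProfile :=
    ⟨fun i j => ⟨Measure.dirac ⟨0, le_rfl, A.v_nonneg i j⟩, inferInstance⟩⟩
  obtain ⟨μ, hμ⟩ := FirstPrice.exists_forall_nonpos φ hφ fun s _ => by
    refine ⟨fun l i j => mixDirac (fun a : s => a.1.1 i j) l,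
      continuous_pi fun i => continuous_pi fun j => continuous_mixDirac _, fun l => ?_⟩
    set μ : A.BidProfile := fun i j => mixDirac (fun a : s => a.1.1 i j) l with hμ
    set σ := μ.toStrategy with hσ
    have hlt : MeasurableSet {z : ℝ × ℝ | z.1 < z.2} := measurableSet_lt'
    -- the average gain of the deviations is at most the total gain in the mixture
    have hgain : ∑ a : s, l.1 a *
        ∑ i, ∑ j, A.p i j * ∫ ω, rampGain a.1.2 i (A.v i j) (a.1.1 i j) ω ∂A.jointLaw σ ≤
        ∫ ω, ∑ i, gain (· < ·) i ω ∂A.jointLaw σ := by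
      rw [sum_integral_gain hlt σ]
      have hbid : ∀ i j, ∫ x, A.interimGain (· < ·) σ i j x ∂(σ.bid i j : Measure ℝ) =
          ∑ a : s, l.1 a * A.interimGain (· < ·) σ i j (a.1.1 i j) := fun i j => by
        rw [hσ, μ.integral_bid, hμ, integral_mixDirac]
      simp only [hbid, Finset.mul_sum]
      rw [Finset.sum_comm]
      refine Finset.sum_le_sum fun i _ => ?_
      rw [Finset.sum_comm]
      refine Finset.sum_le_sum fun j _ => Finset.sum_le_sum fun a _ => ?_
      rw [mul_left_comm]
      refine mul_le_mul_of_nonneg_left (mul_le_mul_of_nonneg_left ?_ (l.2.1 a)) (A.p_pos i j).le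
      exact integral_mono (integrable_rampGain _ _ _ _ _) (integrable_gain_update hlt σ i _ _)
        (rampGain_le _ i (a.1.1 i j).2.2)
    have hsurplus : ∫ ω, ∑ i, gain (· < ·) i ω ∂A.jointLaw σ ≤
        ∑ a : s, l.1 a * ∫ ω, A.relaxedSurplus a.1.2 ω ∂A.jointLaw σ := by
      rw [← one_mul (∫ ω, ∑ i, gain (· < ·) i ω ∂A.jointLaw σ), ← l.2.2, Finset.sum_mul]
      refine Finset.sum_le_sum fun a _ => mul_le_mul_of_nonneg_left ?_ (l.2.1 a)
      refine integral_mono_ae (integrable_finsetSum _ fun i _ => integrable_gain hlt σ i)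
        (integrable_relaxedSurplus _ σ) ?_
      filter_upwards [A.ae_sound σ] with ω hω using hω.sum_gain_lt_le _
    have hsplit : ∑ a : s, l.1 a * φ a μ = ∑ a : s, l.1 a *
        (∑ i, ∑ j, A.p i j * ∫ ω, rampGain a.1.2 i (A.v i j) (a.1.1 i j) ω ∂A.jointLaw σ) -
        ∑ a : s, l.1 a * ∫ ω, A.relaxedSurplus a.1.2 ω ∂A.jointLaw σ := by
      rw [← Finset.sum_sub_distrib]
      exact Finset.sum_congr rfl fun a _ => mul_sub _ _ _
    exact hsplit.trans_le (by linarith)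
  exact ⟨μ.toStrategy, fun x m => sub_nonpos.1 (hμ (x, m))⟩

/-- A profile against which the buyers cannot, by winning all ties at bids of their choice, gain
more in total than the expected surplus. -/
theorem exists_interimGain_le (A : DiscreteAuction n) :
    ∃ σ : A.Strategy, ∀ x : ∀ (i : Fin n) (_ : Fin (A.d i)), ℝ,
      (∀ i j, x i j ∈ Set.Icc (0 : ℝ) (A.v i j)) →
      ∑ i, ∑ j, A.p i j * A.interimGain (· ≤ ·) σ i j (x i j) ≤
        ∫ ω, surplus ω ∂A.jointLaw σ := by
  obtain ⟨σ, hσ⟩ := exists_rampGain_le A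
  refine ⟨σ, fun x hx => ?_⟩
  have hlim : Tendsto (fun m : ℕ => ∑ i, ∑ j, A.p i j *
      (A.interimGain (· ≤ ·) σ i j (x i j) - 1 / ((m : ℝ) + 1))) atTop
      (𝓝 (∑ i, ∑ j, A.p i j * (A.interimGain (· ≤ ·) σ i j (x i j) - 0))) :=
    tendsto_finsetSum _ fun i _ => tendsto_finsetSum _ fun j _ =>
      (tendsto_const_nhds.sub tendsto_one_div_add_atTop_nhds_zero_nat).const_mul _
  simp only [sub_zero] at hlim
  refine le_of_tendsto_of_tendsto' hlim (tendsto_integral_relaxedSurplus σ) fun m => ?_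
  have hmem : ∀ i j, min (x i j + 1 / ((m : ℝ) + 1)) (A.v i j) ∈ Set.Icc (0 : ℝ) (A.v i j) :=
    fun i j => ⟨le_min (add_nonneg (hx i j).1 (by positivity)) (A.v_nonneg i j), min_le_right _ _⟩
  refine le_trans ?_ (hσ (fun i j => ⟨_, hmem i j⟩) m)
  refine Finset.sum_le_sum fun i _ => Finset.sum_le_sum fun j _ =>
    mul_le_mul_of_nonneg_left ?_ (A.p_pos i j).le
  have hint := integrable_gain_update (R := (· ≤ ·)) measurableSet_le' σ i (A.v i j) (x i j)
  have hsub : A.interimGain (· ≤ ·) σ i j (x i j) - 1 / ((m : ℝ) + 1) =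
      ∫ ω, (gain (· ≤ ·) i (Function.update ω i (A.v i j, x i j)) - 1 / ((m : ℝ) + 1))
        ∂A.jointLaw σ := by
    rw [integral_sub hint (integrable_const _)]
    simp [interimGain]
  rw [hsub]
  exact integral_mono (hint.sub (integrable_const _)) (integrable_rampGain _ _ _ _ _)
    fun ω => le_rampGain m i ω

/-- If the buyers cannot gain more in total than the expected surplus by winning all ties at bids
of their choice, then the profile is an equilibrium. Their own bids are such a choice, so ties
between two buyers with positive surplus almost surely do not occur, the utilities are those of a
buyer who wins all ties, and they add up to the expected surplus; a gain of one buyer would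
exceed it. -/
theorem isBayesNash_of_interimGain_le {σ : A.Strategy}
    (hσ : ∀ x : ∀ (i : Fin n) (_ : Fin (A.d i)), ℝ,
      (∀ i j, x i j ∈ Set.Icc (0 : ℝ) (A.v i j)) →
      ∑ i, ∑ j, A.p i j * A.interimGain (· ≤ ·) σ i j (x i j) ≤
        ∫ ω, surplus ω ∂A.jointLaw σ) :
    A.IsBayesNash σ := by
  classical
  have hle : MeasurableSet {z : ℝ × ℝ | z.1 ≤ z.2} := measurableSet_le'
  have hchoice := fun (i : Fin n) (j : Fin (A.d i)) => exists_integral_interimGain_le hle σ i j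
  choose y hy hyle using hchoice
  have hint : Integrable (fun ω => ∑ i, gain (· ≤ ·) i ω) (A.jointLaw σ) :=
    integrable_finsetSum _ fun i _ => integrable_gain hle σ i
  have htotal := sum_integral_gain hle σ
  have hsum_le : ∫ ω, ∑ i, gain (· ≤ ·) i ω ∂A.jointLaw σ ≤ ∫ ω, surplus ω ∂A.jointLaw σ := by
    rw [htotal]
    refine le_trans ?_ (hσ y hy)
    exact Finset.sum_le_sum fun i _ => Finset.sum_le_sum fun j _ =>
      mul_le_mul_of_nonneg_left (hyle i j) (A.p_pos i j).le
  have hsurplus_le : (surplus : (Fin n → ℝ × ℝ) → ℝ) ≤ᵐ[A.jointLaw σ]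
      fun ω => ∑ i, gain (· ≤ ·) i ω := by
    filter_upwards [A.ae_sound σ] with ω hω using hω.surplus_le_sum_gain
  have heq : ∫ ω, surplus ω ∂A.jointLaw σ = ∫ ω, ∑ i, gain (· ≤ ·) i ω ∂A.jointLaw σ :=
    le_antisymm (integral_mono_ae (integrable_surplus σ) hint hsurplus_le) hsum_le
  have hae := (integral_eq_iff_of_ae_le (integrable_surplus σ) hint hsurplus_le).1 heq
  have hutil : ∀ᵐ ω ∂A.jointLaw σ, ∀ i,
      utility (fun k => (ω k).1) (fun k => (ω k).2) i = gain (· ≤ ·) i ω := by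
    filter_upwards [A.ae_sound σ, hae] with ω hω h using hω.utility_eq h.ge
  have hinterim : ∀ i j, ∫ x, A.interimUtility σ i j x ∂(σ.bid i j : Measure ℝ) =
      ∫ x, A.interimGain (· ≤ ·) σ i j x ∂(σ.bid i j : Measure ℝ) := by
    intro i j
    refine integral_congr_ae ?_
    filter_upwards [A.ae_ae_update hutil i j] with x hx
    refine integral_congr_ae ?_
    filter_upwards [hx] with ω hω
    rw [← hω i]
    congr 1 <;> funext k <;> by_cases hk : k = i
    · subst hk; simp
    · simp [hk]
    · subst hk; simp
    · simp [hk]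
  intro i j x hx
  obtain ⟨x', hx', hxx'⟩ := exists_interimUtility_le σ i j hx
  refine hxx'.trans ?_
  rw [hinterim]
  -- buyer `i` with value `v i j` bids `x'`, all others bid at least as well as on average
  let z : ∀ (i : Fin n) (_ : Fin (A.d i)), ℝ := Function.update y i (Function.update (y i) j x')
  have hz : z i j = x' := by simp [z]
  have hz' : ∀ k l, z k l ≠ y k l → (⟨k, l⟩ : Σ i, Fin (A.d i)) = ⟨i, j⟩ := by
    intro k l hne
    by_cases hk : k = i
    · subst hk
      by_cases hl : l = j
      · rw [hl]
      · exact absurd (by simp [z, hl]) hne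
    · exact absurd (by simp [z, hk]) hne
  have hzmem : ∀ k l, z k l ∈ Set.Icc (0 : ℝ) (A.v k l) := by
    intro k l
    by_cases h : z k l = y k l
    · rw [h]; exact hy k l
    · cases hz' k l h
      rw [hz]; exact hx'
  have hbound := hσ z hzmem
  rw [heq, htotal, ← sub_nonpos] at hbound
  simp only [← Finset.sum_sub_distrib, ← mul_sub] at hbound
  by_contra! hcon
  refine absurd hbound (not_le.2 ?_)
  have hterm : ∀ k l, 0 ≤ A.p k l * (A.interimGain (· ≤ ·) σ k l (z k l) -
      ∫ x, A.interimGain (· ≤ ·) σ k l x ∂(σ.bid k l : Measure ℝ)) := by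
    intro k l
    refine mul_nonneg (A.p_pos k l).le (sub_nonneg.2 ?_)
    by_cases h : z k l = y k l
    · rw [h]; exact hyle k l
    · cases hz' k l h
      rw [hz]; exact hcon.le
  refine Finset.sum_pos' (fun k _ => Finset.sum_nonneg fun l _ => hterm k l)
    ⟨i, Finset.mem_univ i, Finset.sum_pos' (fun l _ => hterm i l) ⟨j, Finset.mem_univ j, ?_⟩⟩
  rw [hz]
  exact mul_pos (A.p_pos i j) (sub_pos.2 hcon)

end DiscreteAuction

theorem mainTheorem2 (n : ℕ) (A : DiscreteAuction n) :
    ∃ σ : A.Strategy, A.IsBayesNash σ := by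
  obtain ⟨σ, hσ⟩ := DiscreteAuction.exists_interimGain_le A
  exact ⟨σ, DiscreteAuction.isBayesNash_of_interimGain_le hσ⟩
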